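/- All logarithms are to base $2$, with $\log 0=-\infty$, and exponents take values in $[-\infty,+\infty]$. Let $\mathcal H$ be a finite-dimensional complex Hilbert space. A state is a positive semi-definite operator of trace $1$; a sub-normalised state is a positive semi-definite operator of trace at most $1$; $\le$ between operators is the Löwner order. For sub-normalised states $\rho,\tau$ let $$\mathcal D(\rho,\tau)=\tfrac12\|\rho-\tau\|_1+\tfrac12|\mathrm{Tr}(\rho-\tau)|$$ be the generalised trace distance and $$P(\rho,\tau)=\sqrt{1-F(\rho,\tau)^2},\qquad F(\rho,\tau)=\mathrm{Tr}\sqrt{\sqrt\rho\,\tau\sqrt\rho}+\sqrt{(1-\mathrm{Tr}\rho)(1-\mathrm{Tr}\tau)},$$ the purified distance. For a positive semi-definite operator $\sigma$ let $$D_{\max}(\rho\|\sigma)=\inf\{\lambda\in\mathbb R:\rho\le 2^\lambda\sigma\}$$ and, for $\varepsilon\ge0$ and $d\in\{\mathcal D,P\}$, let $$D_{\max}^{\varepsilon,d}(\rho\|\sigma)=\inf\{D_{\max}(\tau\|\sigma):\tau\text{ a sub-normalised state},\ d(\tau,\rho)\le\varepsilon\}.$$ For $r\in\mathbb R$ let $$\varepsilon^{d}(\rho\|\sigma,r)=\inf\{\varepsilon\ge0: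 D_{\max}^{\varepsilon,d}(\rho\|\sigma)\le r\}$$ be the smallest smoothing parameter at threshold $r$. For $\alpha\in[0,1)$ let $$D_\alpha(\rho\|\sigma)=\frac1{\alpha-1}\log\mathrm{Tr}(\rho^\alpha\sigma^{1-\alpha})\in(-\infty,+\infty]$$ be the Petz Rényi relative entropy, where $\rho^0$ is the projection onto the support of $\rho$. Let $D_1(\rho\|\sigma)=D(\rho\|\sigma)$ be the quantum relative entropy, that is, $\mathrm{Tr}(\rho(\log\rho-\log\sigma))$ if the support of $\rho$ is contained in that of $\sigma$, and $+\infty$ otherwise. With the convention $0\cdot\infty=0$, the expression $(\alpha-1)(r-D_\alpha(\rho\|\sigma))$ equals $0$ at $\alpha=1$. Theorem. Let $\rho$ be a state and $\sigma$ a positive semi-definite operator on $\mathcal H$, and let $r\in\mathbb R$. Then $$\liminf_{n\to\infty}\frac{-\log\big(1-\varepsilon^{\mathcal D}(\rho^{\otimes n}\|\sigma^{\otimes n},nr)\big)}{n}\ \ge\ \sup_{0\le\alpha\le1}(\alpha-1)\big(r-D_\alpha(\rho\|\sigma)\big),$$ $$\liminf_{n\to\infty}\frac{-\log\big(1-\varepsilon^{P}(\rho^{\otimes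 n}\|\sigma^{\otimes n},nr)\big)}{n}\ \ge\ \sup_{0\le\alpha\le1}(\alpha-1)\big(r-D_\alpha(\rho\|\sigma)\big).$$ Moreover, if $\rho$ and $\sigma$ commute, then the following limit exists in $[-\infty,+\infty]$ and $$\lim_{n\to\infty}\frac{-\log\big(1-\varepsilon^{\mathcal D}(\rho^{\otimes n}\|\sigma^{\otimes n},nr)\big)}{n}\ =\ \sup_{0\le\alpha\le1}(\alpha-1)\big(r-D_\alpha(\rho\|\sigma)\big).$$ -/

import Mathlib

open Filter Topology
open scoped ComplexOrder

noncomputable section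

namespace QInfo

variable {ι : Type*} [Fintype ι] [DecidableEq ι]

/-- Normalised states: density matrices on the Hilbert space `ℂ^ι`. -/
def IsState (ρ : Matrix ι ι ℂ) : Prop :=
  ρ.PosSemidef ∧ ρ.trace = 1

/-- Sub-normalised states: positive semi-definite matrices of trace at most one. -/
def IsSubState (ρ : Matrix ι ι ℂ) : Prop :=
  ρ.PosSemidef ∧ ρ.trace.re ≤ 1

/-- The `n`-fold tensor (Kronecker) power `A^{⊗ n}`, an operator on `(ℂ^ι)^{⊗ n} = ℂ^(Fin n → ι)`. -/
def tensorPower {ι : Type*} (A : Matrix ι ι ℂ) (n : ℕ) : Matrix (Fin n → ι) (Fin n → ι) ℂ :=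
  Matrix.of fun x y => ∏ i, A (x i) (y i)

/-- The binary logarithm of a non-negative real, with `log 0 = -∞`. -/
def log2 (x : ℝ) : EReal :=
  if x ≤ 0 then ⊥ else ((Real.logb 2 x : ℝ) : EReal)

/-- The square root of a positive semi-definite matrix (functional calculus). -/
def msqrt (A : Matrix ι ι ℂ) : Matrix ι ι ℂ :=
  cfc Real.sqrt A

/-- The power `A ^ s` of a positive semi-definite matrix, taken on its support:
zero eigenvalues are sent to zero for every `s`, so `A ^ 0` is the projection onto the support. -/
def mpow (A : Matrix ι ι ℂ) (s : ℝ) : Matrix ι ι ℂ :=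
  cfc (fun x : ℝ => if x = 0 then 0 else x ^ s) A

/-- The binary logarithm of a positive semi-definite matrix, taken on its support. -/
def mlog (A : Matrix ι ι ℂ) : Matrix ι ι ℂ :=
  cfc (Real.logb 2) A

/-- The trace norm `‖A‖₁ = Tr √(A† A)`. -/
def traceNorm (A : Matrix ι ι ℂ) : ℝ :=
  (msqrt (A.conjTranspose * A)).trace.re

/-- The generalised trace distance `½ ‖ρ - σ‖₁ + ½ |Tr (ρ - σ)|`. -/
def genTraceDist (ρ σ : Matrix ι ι ℂ) : ℝ :=
  1 / 2 * traceNorm (ρ - σ) + 1 / 2 * |(ρ - σ).trace.re|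

/-- The generalised fidelity `Tr √(√ρ σ √ρ) + √((1 - Tr ρ) (1 - Tr σ))`. -/
def genFidelity (ρ σ : Matrix ι ι ℂ) : ℝ :=
  (msqrt (msqrt ρ * σ * msqrt ρ)).trace.re
    + Real.sqrt ((1 - ρ.trace.re) * (1 - σ.trace.re))

/-- The purified distance `√(1 - F(ρ, σ)²)`. -/
def purifiedDist (ρ σ : Matrix ι ι ℂ) : ℝ :=
  Real.sqrt (1 - genFidelity ρ σ ^ 2)

/-- The max-relative entropy `inf {l | ρ ≤ 2^l σ}` (Löwner order), with values in `[-∞, ∞]`. -/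
def Dmax (ρ σ : Matrix ι ι ℂ) : EReal :=
  ⨅ l ∈ {l : ℝ | ((2 : ℝ) ^ l • σ - ρ).PosSemidef}, (l : EReal)

/-- The smoothed max-relative entropy: the infimum of `Dmax τ σ` over the sub-normalised states `τ`
with `d τ ρ ≤ ε`. -/
def smoothDmax (d : Matrix ι ι ℂ → Matrix ι ι ℂ → ℝ) (ε : ℝ) (ρ σ : Matrix ι ι ℂ) : EReal :=
  ⨅ τ ∈ {τ : Matrix ι ι ℂ | IsSubState τ ∧ d τ ρ ≤ ε}, Dmax τ σ

/-- The smallest smoothing parameter for which the smoothed max-relative entropy is at most `r`. -/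
def minSmoothing (d : Matrix ι ι ℂ → Matrix ι ι ℂ → ℝ) (ρ σ : Matrix ι ι ℂ) (r : ℝ) : ℝ :=
  sInf {ε : ℝ | 0 ≤ ε ∧ smoothDmax d ε ρ σ ≤ (r : EReal)}

/-- The support of `ρ` is contained in the support of `σ` (for Hermitian matrices: `ker σ ⊆ ker ρ`). -/
def SuppLE (ρ σ : Matrix ι ι ℂ) : Prop :=
  ∀ v : ι → ℂ, σ.mulVec v = 0 → ρ.mulVec v = 0

open Classical in
/-- The quantum relative entropy `Tr (ρ (log ρ - log σ))`, which is `∞` unless the support of `ρ` is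
contained in that of `σ`. -/
def relEntropy (ρ σ : Matrix ι ι ℂ) : EReal :=
  if SuppLE ρ σ then (((ρ * (mlog ρ - mlog σ)).trace.re : ℝ) : EReal) else ⊤

open Classical in
/-- The Petz Rényi relative entropy `1 / (α - 1) * log Tr (ρ^α σ^(1 - α))` of order `α ≥ 0`, with
values in `[-∞, ∞]`. At `α = 1` it is the quantum relative entropy; for `α > 1` it is `∞` unless the
support of `ρ` is contained in that of `σ`. -/
def petzRenyi (α : ℝ) (ρ σ : Matrix ι ι ℂ) : EReal :=
  if α = 1 then relEntropy ρ σ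
  else if 1 < α ∧ ¬ SuppLE ρ σ then ⊤
  else ((1 / (α - 1) : ℝ) : EReal) * log2 (mpow ρ α * mpow σ (1 - α)).trace.re

/-- The exponent `-(1/n) log (1 - ε_n)`, where `ε_n` is the smallest smoothing parameter for the
`n`-fold tensor powers at threshold `n r`. -/
def scExponent (d : ∀ n : ℕ, Matrix (Fin n → ι) (Fin n → ι) ℂ → Matrix (Fin n → ι) (Fin n → ι) ℂ → ℝ)
    (ρ σ : Matrix ι ι ℂ) (r : ℝ) (n : ℕ) : EReal :=
  -log2 (1 - minSmoothing (d n) (tensorPower ρ n) (tensorPower σ n) (n * r)) / (n : EReal)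

/-- The value `sup_{0 ≤ α ≤ 1} (α - 1) (r - D_α(ρ‖σ))` in `[-∞, ∞]`; the term at `α = 1` is `0`. -/
def renyiBound (ρ σ : Matrix ι ι ℂ) (r : ℝ) : EReal :=
  ⨆ α ∈ Set.Icc (0 : ℝ) 1, ((α - 1 : ℝ) : EReal) * ((r : EReal) - petzRenyi α ρ σ)

end QInfo

end

/-!
The exponents in question measure how fast `1 - ε_n` decays, where `ε_n` is the infimal distance from
`ρ^{⊗ n}` to a sub-normalised state below `2^{n r} σ^{⊗ n}`.

*Lower bounds.* For a sub-normalised state `τ` the generalised trace distance to a state `ρ` is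
`Tr (ρ - τ)₊`. Audenaert's inequality (`trace_sub_trace_le_trace_mpow_mul_mpow`) bounds
`1 - Tr (ρ - τ)₊` by `Tr ρ^α τ^(1-α)`, and if `τ ≤ 2^l σ`, operator monotonicity of `x ↦ x^(1-α)`
bounds this by `2^(l (1-α)) Tr ρ^α σ^(1-α)` (`one_sub_genTraceDist_le`). Traces of powers are
multiplicative under tensor powers, so the bound for `n` copies is the `n`-th power of the one for a
single copy; its logarithm is `-n` times the term of the supremum at `α`. The term at `α = 1`
is `0`, which only says `ε_n ≥ 0`. The purified distance is at least the generalised trace distance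
(`genTraceDist_le_purifiedDist`), so its exponent is at least as large.

*Commuting operators.* If `ρ` and `σ` are diagonal in one basis with eigenvalues `p` and `q`, the
operator `min (p^{⊗ n}, 2^{n r} q^{⊗ n})` is admissible, whence
`1 - ε_n ≥ ∑ x, min (p^{⊗ n} x, 2^{n r} q^{⊗ n} x)`. By the classical Chernoff bound
(`exists_chernoff_exponent`) this sum is at least `exp (-K √n)` times the `n`-th power of
`∑ p^α (2^r q)^(1-α)` at the minimising `α ∈ [0, 1]`, where `p` and `q` are restricted to their
common support. For `α < 1` the negative logarithm of that quantity is a term of the supremum, and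
for `α = 1` it is a limit of such terms (`neg_logb_partitionFn_le_renyiBound`). If the common support
is empty, the supremum is `⊤`.
-/

namespace QInfo

/-! ### Diagonalisation and functional calculus -/

section Diagonalisation

open scoped MatrixOrder Matrix

variable {ι : Type*} [Fintype ι] [DecidableEq ι]

/-- The operator `U diag(a) U†`. For unitary `U` it has eigenvalue `a i` at the `i`-th column
of `U`. -/
noncomputable def diagIn (U : Matrix ι ι ℂ) (a : ι → ℝ) : Matrix ι ι ℂ :=
  U * Matrix.diagonal (fun i => (a i : ℂ)) * Uᴴ

lemma diagIn_sub (U : Matrix ι ι ℂ) (a b : ι → ℝ) :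
    diagIn U a - diagIn U b = diagIn U (a - b) := by
  simp only [diagIn, ← Matrix.sub_mul, ← Matrix.mul_sub, Matrix.diagonal_sub]
  simp

lemma smul_diagIn (c : ℝ) (U : Matrix ι ι ℂ) (a : ι → ℝ) :
    c • diagIn U a = diagIn U (c • a) := by
  have : (Matrix.diagonal fun i => (((c • a) i : ℝ) : ℂ))
      = c • Matrix.diagonal (fun i => (a i : ℂ)) := by
    rw [← Matrix.diagonal_smul]
    congr 1
    ext i
    simp
  simp only [diagIn, this, Matrix.mul_smul, Matrix.smul_mul]

lemma posSemidef_diagIn (U : Matrix ι ι ℂ) {a : ι → ℝ} (ha : ∀ i, 0 ≤ a i) :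
    (diagIn U a).PosSemidef := by
  refine Matrix.PosSemidef.mul_mul_conjTranspose_same (Matrix.PosSemidef.diagonal ?_) U
  intro i
  simpa using ha i

lemma diagIn_mul {U : Matrix ι ι ℂ} (hU : Uᴴ * U = 1) (a b : ι → ℝ) :
    diagIn U a * diagIn U b = diagIn U (a * b) := by
  have : (Matrix.diagonal fun i => (((a * b) i : ℝ) : ℂ))
      = Matrix.diagonal (fun i => (a i : ℂ)) * Matrix.diagonal (fun i => (b i : ℂ)) := by
    rw [Matrix.diagonal_mul_diagonal]
    simp
  rw [diagIn, diagIn, diagIn, this]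
  calc _ = U * Matrix.diagonal (fun i => (a i : ℂ)) * (Uᴴ * U)
        * Matrix.diagonal (fun i => (b i : ℂ)) * Uᴴ := by simp only [Matrix.mul_assoc]
    _ = _ := by simp only [hU, Matrix.mul_one, Matrix.mul_assoc]

lemma trace_diagIn {U : Matrix ι ι ℂ} (hU : Uᴴ * U = 1) (a : ι → ℝ) :
    (diagIn U a).trace = ((∑ i, a i : ℝ) : ℂ) := by
  rw [diagIn, Matrix.mul_assoc, Matrix.trace_mul_comm, Matrix.mul_assoc, hU, Matrix.mul_one,
    Matrix.trace_diagonal]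
  simp

lemma nonneg_of_posSemidef_diagIn {U : Matrix ι ι ℂ} (hU : Uᴴ * U = 1) {a : ι → ℝ}
    (h : (diagIn U a).PosSemidef) (i : ι) : 0 ≤ a i := by
  have h' := h.conjTranspose_mul_mul_same U
  have e : Uᴴ * diagIn U a * U = Matrix.diagonal (fun i => (a i : ℂ)) := by
    calc _ = (Uᴴ * U) * Matrix.diagonal (fun i => (a i : ℂ)) * (Uᴴ * U) := by
          simp only [diagIn, Matrix.mul_assoc]
      _ = _ := by rw [hU, Matrix.one_mul, Matrix.mul_one]
  rw [e, Matrix.posSemidef_diagonal_iff] at h'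
  simpa using h' i

/-- `a ↦ U diag(a) U†` as a homomorphism of real algebras. -/
noncomputable def diagInAlgHom {U : Matrix ι ι ℂ} (hU : Uᴴ * U = 1) :
    (ι → ℝ) →ₐ[ℝ] Matrix ι ι ℂ :=
  AlgHom.ofLinearMap
    { toFun := diagIn U
      map_add' := fun a b => by
        have := diagIn_sub U (a + b) b
        rw [add_sub_cancel_right, sub_eq_iff_eq_add] at this
        exact this
      map_smul' := fun c a => (smul_diagIn c U a).symm }
    (by simpa [diagIn] using mul_eq_one_comm.1 hU)
    (fun a b => (diagIn_mul hU a b).symm)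

/-- The continuous functional calculus acts on eigenvalues: on the finite spectrum the function
agrees with an interpolation polynomial, and polynomials commute with algebra homomorphisms. -/
lemma cfc_diagIn {U : Matrix ι ι ℂ} (hU : Uᴴ * U = 1) (a : ι → ℝ) (f : ℝ → ℝ) :
    cfc f (diagIn U a) = diagIn U (fun i => f (a i)) := by
  have hA : IsSelfAdjoint (diagIn U a) := by
    rw [isSelfAdjoint_iff, Matrix.star_eq_conjTranspose, diagIn]
    simp [Matrix.mul_assoc, Pi.star_def]
  have hspec : spectrum ℝ (diagIn U a) ⊆ Set.range a := by
    refine (AlgHom.spectrum_apply_subset (diagInAlgHom hU) a).trans ?_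
    intro x hx
    rw [Pi.spectrum_eq, Set.mem_iUnion] at hx
    obtain ⟨i, hi⟩ := hx
    rw [← Algebra.algebraMap_self_apply (a i)] at hi
    have : Nontrivial ℝ := inferInstance
    rw [spectrum.scalar_eq] at hi
    exact ⟨i, hi.symm⟩
  let q := Lagrange.interpolate (Finset.univ.image a) id f
  have hq : ∀ i, q.eval (a i) = f (a i) := fun i =>
    Lagrange.eval_interpolate_at_node f (Set.injOn_id _)
      (Finset.mem_image_of_mem a (Finset.mem_univ i))
  rw [cfc_congr (g := q.eval) fun x hx => by
      obtain ⟨i, rfl⟩ := hspec hx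
      exact (hq i).symm,
    cfc_polynomial q (diagIn U a)]
  change Polynomial.aeval (diagInAlgHom hU a) q = diagInAlgHom hU _
  rw [Polynomial.aeval_algHom_apply]
  congr 1
  ext i
  rw [← hq i, ← Polynomial.coe_aeval_eq_eval]
  exact (Polynomial.aeval_algHom_apply (Pi.evalAlgHom ℝ (fun _ : ι => ℝ) i) a q).symm

lemma exists_diagIn_of_isHermitian {A : Matrix ι ι ℂ} (hA : A.IsHermitian) :
    ∃ (U : Matrix ι ι ℂ) (a : ι → ℝ), Uᴴ * U = 1 ∧ A = diagIn U a := by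
  refine ⟨hA.eigenvectorUnitary, hA.eigenvalues,
    Matrix.mem_unitaryGroup_iff'.1 hA.eigenvectorUnitary.2, ?_⟩
  conv_lhs => rw [hA.spectral_theorem]
  rfl

/-- If the columns of the unitary matrix of an orthonormal basis are eigenvectors of `A`, then `A`
is diagonal in that basis. -/
lemma eq_diagIn_of_basis {A : Matrix ι ι ℂ} (hA : A.IsHermitian)
    (b : OrthonormalBasis ι ℂ (EuclideanSpace ℂ ι))
    (hb : ∀ i, ∃ c : ℂ, Matrix.toEuclideanLin A (b i) = c • b i) :
    ∃ a : ι → ℝ, A = diagIn ((EuclideanSpace.basisFun ι ℂ).toBasis.toMatrix b.toBasis) a := by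
  choose c hc using hb
  have hreal : ∀ i, ((c i).re : ℂ) = c i := fun i => by
    have hs := Matrix.isSymmetric_toEuclideanLin_iff.2 hA (b i) (b i)
    rw [hc, inner_smul_left, inner_smul_right, b.inner_eq_one, mul_one, mul_one] at hs
    exact Complex.conj_eq_iff_re.1 hs
  set U := (EuclideanSpace.basisFun ι ℂ).toBasis.toMatrix b.toBasis with hUdef
  have hUU : U * Uᴴ = 1 := Matrix.mem_unitaryGroup_iff.1
    ((EuclideanSpace.basisFun ι ℂ).toMatrix_orthonormalBasis_mem_unitary b)
  refine ⟨fun i => (c i).re, ?_⟩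
  have hAU : A * U = U * Matrix.diagonal (fun i => (((c i).re : ℝ) : ℂ)) := by
    ext i j
    rw [Matrix.mul_diagonal, hreal]
    have := congrArg (fun v : EuclideanSpace ℂ ι => v i) (hc j)
    simp only [Matrix.toLpLin_apply, PiLp.smul_apply, smul_eq_mul] at this
    rw [mul_comm, show U i j = b j i from rfl, ← this]
    rfl
  rw [diagIn, ← hAU, Matrix.mul_assoc, hUU, Matrix.mul_one]

/-- Commuting Hermitian matrices are simultaneously diagonalisable: an eigenspace of the first is
invariant under the second, so it has an orthonormal basis of eigenvectors of the second. -/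
lemma exists_joint_diagIn {A B : Matrix ι ι ℂ} (hA : A.IsHermitian) (hB : B.IsHermitian)
    (hAB : Commute A B) :
    ∃ (U : Matrix ι ι ℂ) (a b : ι → ℝ), Uᴴ * U = 1 ∧ A = diagIn U a ∧ B = diagIn U b := by
  classical
  set S := Matrix.toEuclideanLin A with hSdef
  set T := Matrix.toEuclideanLin B with hTdef
  have hS : S.IsSymmetric := Matrix.isSymmetric_toEuclideanLin_iff.2 hA
  have hT : T.IsSymmetric := Matrix.isSymmetric_toEuclideanLin_iff.2 hB
  have hST : Commute S T := by
    change S * T = T * S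
    ext v : 1
    simp only [hSdef, hTdef, Module.End.mul_apply, Matrix.toLpLin_apply, Matrix.mulVec_mulVec,
      hAB.eq]
  have hinv : ∀ μ : Module.End.Eigenvalues S, ∀ v ∈ Module.End.eigenspace S (μ : ℂ),
      T v ∈ Module.End.eigenspace S (μ : ℂ) := fun μ v hv =>
    Module.End.mapsTo_genEigenspace_of_comm hST (μ : ℂ) 1 hv
  let e := DirectSum.IsInternal.collectedOrthonormalBasis hS.orthogonalFamily_eigenspaces'
    hS.direct_sum_isInternal
    (fun μ => (hT.restrict_invariant (hinv μ)).eigenvectorBasis rfl)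
  have hcard : Fintype.card
      ((μ : Module.End.Eigenvalues S) × Fin (Module.finrank ℂ (Module.End.eigenspace S (μ : ℂ))))
        = Fintype.card ι := by
    rw [← Module.finrank_eq_card_basis e.toBasis, finrank_euclideanSpace]
  let b := e.reindex (Fintype.equivOfCardEq hcard)
  have hbS : ∀ i, ∃ c : ℂ, S (b i) = c • b i := fun i => by
    refine ⟨(((Fintype.equivOfCardEq hcard).symm i).1 : ℂ), Module.End.mem_eigenspace_iff.1 ?_⟩
    rw [OrthonormalBasis.reindex_apply]
    exact DirectSum.IsInternal.collectedOrthonormalBasis_mem hS.direct_sum_isInternal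
      hS.orthogonalFamily_eigenspaces' _ _
  have hbT : ∀ i, ∃ c : ℂ, T (b i) = c • b i := fun i => by
    obtain ⟨⟨μ, k⟩, rfl⟩ := (Fintype.equivOfCardEq hcard).surjective i
    have he : e ⟨μ, k⟩ = ((hT.restrict_invariant (hinv μ)).eigenvectorBasis rfl k :
        Module.End.eigenspace S (μ : ℂ)) := by
      simp [e, DirectSum.IsInternal.collectedOrthonormalBasis]
    have := congrArg Subtype.val ((hT.restrict_invariant (hinv μ)).apply_eigenvectorBasis rfl k)
    simp only [b, OrthonormalBasis.reindex_apply, Equiv.symm_apply_apply, he]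
    exact ⟨_, this⟩
  obtain ⟨a, ha⟩ := eq_diagIn_of_basis hA b hbS
  obtain ⟨a', ha'⟩ := eq_diagIn_of_basis hB b hbT
  exact ⟨_, a, a', Matrix.mem_unitaryGroup_iff'.1
    ((EuclideanSpace.basisFun ι ℂ).toMatrix_orthonormalBasis_mem_unitary b), ha, ha'⟩

end Diagonalisation

/-! ### Tensor powers -/

section TensorPower

open scoped MatrixOrder Matrix

variable {ι : Type*}

lemma tensorPower_mul [Fintype ι] (A B : Matrix ι ι ℂ) (n : ℕ) :
    tensorPower (A * B) n = tensorPower A n * tensorPower B n := by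
  ext x y
  simp only [tensorPower, Matrix.of_apply, Matrix.mul_apply, Finset.prod_univ_sum,
    Fintype.piFinset_univ, Finset.prod_mul_distrib]

lemma tensorPower_conjTranspose (A : Matrix ι ι ℂ) (n : ℕ) :
    tensorPower Aᴴ n = (tensorPower A n)ᴴ := by
  ext x y
  simp [tensorPower, Matrix.conjTranspose_apply]

lemma tensorPower_diagonal [DecidableEq ι] (d : ι → ℂ) (n : ℕ) :
    tensorPower (Matrix.diagonal d) n = Matrix.diagonal fun x : Fin n → ι => ∏ i, d (x i) := by
  ext x y
  by_cases h : x = y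
  · subst h
    simp [tensorPower]
  · obtain ⟨i, hi⟩ := Function.ne_iff.1 h
    rw [Matrix.diagonal_apply_ne _ h]
    exact Finset.prod_eq_zero (Finset.mem_univ i) (Matrix.diagonal_apply_ne _ hi)

lemma tensorPower_one [DecidableEq ι] (n : ℕ) : tensorPower (1 : Matrix ι ι ℂ) n = 1 := by
  rw [← Matrix.diagonal_one, tensorPower_diagonal]
  simp

variable [Fintype ι]

lemma sum_prod_eq_pow {R : Type*} [CommSemiring R] (f : ι → R) (n : ℕ) :
    ∑ x : Fin n → ι, ∏ i, f (x i) = (∑ i, f i) ^ n := by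
  have := Finset.prod_univ_sum (fun _ : Fin n => (Finset.univ : Finset ι)) (fun _ => f)
  simpa using this.symm

lemma trace_tensorPower (A : Matrix ι ι ℂ) (n : ℕ) :
    (tensorPower A n).trace = A.trace ^ n := by
  simpa [Matrix.trace, tensorPower] using sum_prod_eq_pow (fun i => A i i) n

variable [DecidableEq ι]

lemma tensorPower_unitary {U : Matrix ι ι ℂ} (hU : Uᴴ * U = 1) (n : ℕ) :
    (tensorPower U n)ᴴ * tensorPower U n = 1 := by
  rw [← tensorPower_conjTranspose, ← tensorPower_mul, hU, tensorPower_one]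

lemma tensorPower_diagIn (U : Matrix ι ι ℂ) (a : ι → ℝ) (n : ℕ) :
    tensorPower (diagIn U a) n = diagIn (tensorPower U n) fun x => ∏ i, a (x i) := by
  rw [diagIn, diagIn, tensorPower_mul, tensorPower_mul, tensorPower_diagonal,
    tensorPower_conjTranspose]
  simp

lemma posSemidef_tensorPower {A : Matrix ι ι ℂ} (hA : A.PosSemidef) (n : ℕ) :
    (tensorPower A n).PosSemidef := by
  obtain ⟨U, a, hU, rfl⟩ := exists_diagIn_of_isHermitian hA.1
  rw [tensorPower_diagIn]
  exact posSemidef_diagIn _ fun x =>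
    Finset.prod_nonneg fun i _ => nonneg_of_posSemidef_diagIn hU hA _

lemma mpow_tensorPower {A : Matrix ι ι ℂ} (hA : A.PosSemidef) (s : ℝ) (n : ℕ) :
    mpow (tensorPower A n) s = tensorPower (mpow A s) n := by
  obtain ⟨U, a, hU, rfl⟩ := exists_diagIn_of_isHermitian hA.1
  have ha := nonneg_of_posSemidef_diagIn hU hA
  rw [tensorPower_diagIn, mpow, mpow, cfc_diagIn hU, cfc_diagIn (tensorPower_unitary hU n),
    tensorPower_diagIn]
  congr 1
  ext x
  by_cases h : ∏ i, a (x i) = 0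
  · rw [if_pos h]
    obtain ⟨i, hi, h0⟩ := Finset.prod_eq_zero_iff.1 h
    exact (Finset.prod_eq_zero (f := fun i => if a (x i) = 0 then 0 else a (x i) ^ s)
      hi (if_pos h0)).symm
  · rw [if_neg h, ← Real.finsetProd_rpow _ _ (fun i _ => ha _)]
    refine Finset.prod_congr rfl fun i hi => (if_neg ?_).symm
    exact Finset.prod_ne_zero_iff.1 h i hi

lemma IsState.tensorPower {ρ : Matrix ι ι ℂ} (hρ : IsState ρ) (n : ℕ) :
    IsState (tensorPower ρ n) :=
  ⟨posSemidef_tensorPower hρ.1 n, by rw [trace_tensorPower, hρ.2, one_pow]⟩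

end TensorPower

/-! ### Trace inequalities and the one-shot converse -/

section TraceInequalities

open scoped MatrixOrder Matrix

variable {ι : Type*} [Fintype ι] [DecidableEq ι]

lemma mpow_diagIn {U : Matrix ι ι ℂ} (hU : Uᴴ * U = 1) (a : ι → ℝ) (s : ℝ) :
    mpow (diagIn U a) s = diagIn U fun i => if a i = 0 then 0 else a i ^ s :=
  cfc_diagIn hU a _

lemma posSemidef_mpow {A : Matrix ι ι ℂ} (hA : A.PosSemidef) (s : ℝ) : (mpow A s).PosSemidef := by
  obtain ⟨U, a, hU, rfl⟩ := exists_diagIn_of_isHermitian hA.1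
  have ha := nonneg_of_posSemidef_diagIn hU hA
  rw [mpow_diagIn hU]
  refine posSemidef_diagIn _ fun i => ?_
  split_ifs
  · exact le_rfl
  · exact Real.rpow_nonneg (ha i) s

lemma mpow_mul_mpow_one_sub {A : Matrix ι ι ℂ} (hA : A.PosSemidef) (s : ℝ) :
    mpow A s * mpow A (1 - s) = A := by
  obtain ⟨U, a, hU, rfl⟩ := exists_diagIn_of_isHermitian hA.1
  have ha := nonneg_of_posSemidef_diagIn hU hA
  rw [mpow_diagIn hU, mpow_diagIn hU, diagIn_mul hU]
  congr 1
  ext i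
  by_cases h : a i = 0
  · simp [h]
  · have hpos : 0 < a i := lt_of_le_of_ne (ha i) (Ne.symm h)
    simp [h, ← Real.rpow_add hpos]

lemma mpow_smul {A : Matrix ι ι ℂ} (hA : A.PosSemidef) {c : ℝ} (hc : 0 < c) (s : ℝ) :
    mpow (c • A) s = c ^ s • mpow A s := by
  obtain ⟨U, a, hU, rfl⟩ := exists_diagIn_of_isHermitian hA.1
  have ha := nonneg_of_posSemidef_diagIn hU hA
  rw [smul_diagIn, mpow_diagIn hU, mpow_diagIn hU, smul_diagIn]
  congr 1
  ext i
  by_cases h : a i = 0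
  · simp [h]
  · simp [h, hc.ne', Real.mul_rpow hc.le (ha i)]

lemma mpow_eq_rpow {A : Matrix ι ι ℂ} (hA : 0 ≤ A) {s : ℝ} (hs : s ≠ 0) : mpow A s = A ^ s := by
  rw [CFC.rpow_eq_cfc_real hA, mpow]
  congr 1
  ext x
  split_ifs with hx
  · rw [hx, Real.zero_rpow hs]
  · rfl

/-- The Löwner–Heinz theorem. The exponent `0`, which gives support projections here, is not
covered. -/
lemma mpow_le_mpow {A B : Matrix ι ι ℂ} (hA : 0 ≤ A) (hAB : A ≤ B) {s : ℝ} (hs : 0 < s)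
    (hs1 : s ≤ 1) : mpow A s ≤ mpow B s := by
  rw [mpow_eq_rpow hA hs.ne', mpow_eq_rpow (hA.trans hAB) hs.ne']
  open scoped Matrix.Norms.L2Operator in
  exact CFC.rpow_le_rpow ⟨hs.le, hs1⟩ hAB

lemma mpow_zero_le_one {A : Matrix ι ι ℂ} (hA : A.PosSemidef) : mpow A 0 ≤ 1 := by
  obtain ⟨U, a, hU, rfl⟩ := exists_diagIn_of_isHermitian hA.1
  have h1 : (1 : Matrix ι ι ℂ) = diagIn U 1 := by
    simpa [diagIn] using (mul_eq_one_comm.1 hU).symm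
  rw [mpow_diagIn hU, h1, Matrix.le_iff, diagIn_sub]
  refine posSemidef_diagIn _ fun i => ?_
  by_cases h : a i = 0 <;> simp [h]

lemma re_trace_mul_nonneg {A B : Matrix ι ι ℂ} (hA : A.PosSemidef) (hB : B.PosSemidef) :
    0 ≤ (A * B).trace.re := by
  obtain ⟨U, b, hU, rfl⟩ := exists_diagIn_of_isHermitian hB.1
  have hb := nonneg_of_posSemidef_diagIn hU hB
  have e : (A * diagIn U b).trace = ((Uᴴ * A * U) * Matrix.diagonal fun i => (b i : ℂ)).trace := by
    rw [diagIn, ← Matrix.mul_assoc, Matrix.trace_mul_comm]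
    simp only [Matrix.mul_assoc]
  rw [e, Matrix.trace, Complex.re_sum]
  refine Finset.sum_nonneg fun i _ => ?_
  rw [Matrix.diag_apply, Matrix.mul_diagonal, Complex.re_mul_ofReal]
  exact mul_nonneg (Complex.le_def.1 ((hA.conjTranspose_mul_mul_same U).diag_nonneg (i := i))).1
    (hb i)

lemma re_trace_mul_le_left {A B C : Matrix ι ι ℂ} (hAB : A ≤ B) (hC : 0 ≤ C) :
    (C * A).trace.re ≤ (C * B).trace.re := by
  have := re_trace_mul_nonneg (Matrix.nonneg_iff_posSemidef.1 hC) (Matrix.le_iff.1 hAB)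
  rw [Matrix.mul_sub, Matrix.trace_sub, Complex.sub_re] at this
  linarith

lemma re_trace_mul_le_right {A B C : Matrix ι ι ℂ} (hAB : A ≤ B) (hC : 0 ≤ C) :
    (A * C).trace.re ≤ (B * C).trace.re := by
  rw [Matrix.trace_mul_comm A, Matrix.trace_mul_comm B]
  exact re_trace_mul_le_left hAB hC

/-- Audenaert's inequality `Tr A - Tr (A - B)₊ ≤ Tr A^α B^(1-α)`, with any `M ≥ 0`, `M ≥ A - B` in
place of the positive part. For `α > 0` it follows from operator monotonicity of `x ↦ x^α` and
`x ↦ x^(1-α)` by comparing `A` and `B` with `B + M`, which dominates both. -/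
lemma trace_sub_trace_le_trace_mpow_mul_mpow {A B M : Matrix ι ι ℂ} (hA : 0 ≤ A) (hB : 0 ≤ B)
    (hM : 0 ≤ M) (hABM : A - B ≤ M) {α : ℝ} (h0 : 0 ≤ α) (h1 : α < 1) :
    A.trace.re - M.trace.re ≤ (mpow A α * mpow B (1 - α)).trace.re := by
  have hA' := Matrix.nonneg_iff_posSemidef.1 hA
  have hB' := Matrix.nonneg_iff_posSemidef.1 hB
  rcases h0.eq_or_lt with rfl | h0
  · have e1 : mpow B (1 - 0) = B := by
      rw [mpow_eq_rpow hB (by norm_num), sub_zero, CFC.rpow_one B hB]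
    have e2 : mpow A 0 * A = A := by
      have := mpow_mul_mpow_one_sub hA' 0
      rwa [mpow_eq_rpow hA (by norm_num : (1 - 0 : ℝ) ≠ 0), sub_zero, CFC.rpow_one A hA] at this
    have h2 := re_trace_mul_le_left hABM (posSemidef_mpow hA' 0).nonneg
    have h3 := re_trace_mul_le_right (mpow_zero_le_one hA') hM
    rw [Matrix.mul_sub, e2, Matrix.trace_sub, Complex.sub_re] at h2
    rw [Matrix.one_mul] at h3
    rw [e1]
    linarith
  · have hs : 0 < 1 - α := by linarith
    set C := B + M with hCdef
    have hBC : B ≤ C := le_add_of_nonneg_right hM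
    have hAC : A ≤ C := by
      have := sub_le_iff_le_add.1 hABM
      rwa [add_comm] at this
    have hC : 0 ≤ C := hA.trans hAC
    have t1 := re_trace_mul_le_left (mpow_le_mpow hA hAC hs (by linarith))
      (posSemidef_mpow hA' α).nonneg
    have t2 := re_trace_mul_le_right (mpow_le_mpow hA hAC h0 h1.le)
      (sub_nonneg.2 (mpow_le_mpow hB hBC hs (by linarith)))
    have t3 := re_trace_mul_le_right (mpow_le_mpow hB hBC h0 h1.le)
      (posSemidef_mpow hB' (1 - α)).nonneg
    rw [mpow_mul_mpow_one_sub hA'] at t1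
    rw [Matrix.mul_sub, Matrix.mul_sub, mpow_mul_mpow_one_sub
      (Matrix.nonneg_iff_posSemidef.1 hC), Matrix.trace_sub, Matrix.trace_sub, Complex.sub_re,
      Complex.sub_re, hCdef, Matrix.trace_add, Complex.add_re, ← hCdef] at t2
    rw [mpow_mul_mpow_one_sub hB'] at t3
    linarith

lemma msqrt_diagIn {U : Matrix ι ι ℂ} (hU : Uᴴ * U = 1) (a : ι → ℝ) :
    msqrt (diagIn U a) = diagIn U fun i => √(a i) :=
  cfc_diagIn hU a _

lemma conjTranspose_diagIn (U : Matrix ι ι ℂ) (a : ι → ℝ) : (diagIn U a)ᴴ = diagIn U a := by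
  simp [diagIn, Matrix.mul_assoc, Pi.star_def]

lemma traceNorm_diagIn {U : Matrix ι ι ℂ} (hU : Uᴴ * U = 1) (a : ι → ℝ) :
    traceNorm (diagIn U a) = ∑ i, |a i| := by
  rw [traceNorm, conjTranspose_diagIn, diagIn_mul hU, msqrt_diagIn hU, trace_diagIn hU,
    Complex.ofReal_re]
  simp [Real.sqrt_mul_self_eq_abs]

lemma genTraceDist_eq_of_sub_state {ρ τ : Matrix ι ι ℂ} (hρ : IsState ρ) (hτ : IsSubState τ) :
    genTraceDist τ ρ = 1 / 2 * traceNorm (ρ - τ) + 1 / 2 * (ρ - τ).trace.re := by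
  have h : 0 ≤ (ρ - τ).trace.re := by
    rw [Matrix.trace_sub, hρ.2, Complex.sub_re, Complex.one_re]
    linarith [hτ.2]
  rw [genTraceDist, ← neg_sub ρ τ, Matrix.trace_neg, Complex.neg_re, abs_neg, abs_of_nonneg h]
  congr 2
  simp only [traceNorm, Matrix.conjTranspose_neg, neg_mul_neg]

/-- Neyman–Pearson: the spectral projection `P` of `ρ - τ` onto the positive eigenvalues and the
positive part `M = P (ρ - τ)` attain the generalised trace distance. -/
lemma exists_projection_genTraceDist {ρ τ : Matrix ι ι ℂ} (hρ : IsState ρ) (hτ : IsSubState τ) :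
    ∃ P M : Matrix ι ι ℂ, Pᴴ = P ∧ P * P = P ∧ 0 ≤ P ∧ M = P * (ρ - τ) ∧ 0 ≤ M ∧ ρ - τ ≤ M ∧
      genTraceDist τ ρ = M.trace.re := by
  obtain ⟨U, a, hU, ha⟩ := exists_diagIn_of_isHermitian (hρ.1.1.sub hτ.1.1)
  refine ⟨diagIn U fun i => if 0 < a i then 1 else 0, diagIn U fun i => max (a i) 0,
    conjTranspose_diagIn _ _, ?_, ?_, ?_, ?_, ?_, ?_⟩
  · rw [diagIn_mul hU]
    congr 1
    ext i
    by_cases h : 0 < a i <;> simp [h]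
  · refine (posSemidef_diagIn _ fun i => ?_).nonneg
    split_ifs <;> norm_num
  · rw [ha, diagIn_mul hU]
    congr 1
    ext i
    by_cases h : 0 < a i
    · simp [h, h.le]
    · simp [h, not_lt.1 h]
  · exact (posSemidef_diagIn _ fun i => le_max_right _ _).nonneg
  · rw [ha, Matrix.le_iff, diagIn_sub]
    exact posSemidef_diagIn _ fun i => sub_nonneg.2 (le_max_left _ _)
  · rw [genTraceDist_eq_of_sub_state hρ hτ, ha, traceNorm_diagIn hU, trace_diagIn hU,
      trace_diagIn hU, Complex.ofReal_re, Complex.ofReal_re, ← mul_add, ← Finset.sum_add_distrib,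
      Finset.mul_sum]
    refine Finset.sum_congr rfl fun i _ => ?_
    rcases le_total 0 (a i) with h | h
    · rw [abs_of_nonneg h, max_eq_left h]
      ring
    · rw [abs_of_nonpos h, max_eq_right h]
      ring

/-- One-shot converse: a state within generalised trace distance `ε` of `ρ` and dominated by
`2^l σ` forces `1 - ε ≤ 2^(l (1-α)) Tr ρ^α σ^(1-α)`. -/
lemma one_sub_genTraceDist_le {ρ σ τ : Matrix ι ι ℂ} (hρ : IsState ρ) (hσ : σ.PosSemidef)
    (hτ : IsSubState τ) {l : ℝ} (hl : ((2 : ℝ) ^ l • σ - τ).PosSemidef) {α : ℝ} (h0 : 0 ≤ α)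
    (h1 : α < 1) :
    1 - genTraceDist τ ρ
      ≤ (2 : ℝ) ^ (l * (1 - α)) * (mpow ρ α * mpow σ (1 - α)).trace.re := by
  obtain ⟨P, M, -, -, -, -, hM0, hM, hD⟩ := exists_projection_genTraceDist hρ hτ
  have k1 := trace_sub_trace_le_trace_mpow_mul_mpow hρ.1.nonneg hτ.1.nonneg hM0 hM h0 h1
  have k2 := re_trace_mul_le_left (mpow_le_mpow hτ.1.nonneg (Matrix.le_iff.2 hl)
    (sub_pos.2 h1) (by linarith)) (posSemidef_mpow hρ.1 α).nonneg
  rw [mpow_smul hσ (by positivity), ← Real.rpow_mul (by norm_num), Matrix.mul_smul,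
    Matrix.trace_smul, Complex.smul_re, smul_eq_mul] at k2
  rw [hρ.2, Complex.one_re, ← hD] at k1
  exact k1.trans k2

end TraceInequalities

/-! ### The Fuchs–van de Graaf inequality -/

section FuchsVanDeGraaf

open scoped MatrixOrder Matrix

variable {ι : Type*} [Fintype ι]

lemma re_trace_mul_conjTranspose_comm (A B : Matrix ι ι ℂ) :
    (B * Aᴴ).trace.re = (A * Bᴴ).trace.re := by
  have : B * Aᴴ = (A * Bᴴ)ᴴ := by
    rw [Matrix.conjTranspose_mul, Matrix.conjTranspose_conjTranspose]
  rw [this, Matrix.trace_conjTranspose]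
  exact Complex.conj_re _

lemma two_mul_re_trace_mul_conjTranspose_le (A B : Matrix ι ι ℂ) :
    2 * (A * Bᴴ).trace.re ≤ (A * Aᴴ).trace.re + (B * Bᴴ).trace.re := by
  have h := (Complex.le_def.1
    (Matrix.posSemidef_self_mul_conjTranspose (A - B)).trace_nonneg).1
  have hc := re_trace_mul_conjTranspose_comm A B
  simp only [Matrix.conjTranspose_sub, Matrix.sub_mul, Matrix.mul_sub, Matrix.trace_sub,
    Complex.sub_re, Complex.zero_re] at h
  linarith

variable [DecidableEq ι]

lemma posSemidef_msqrt (A : Matrix ι ι ℂ) (hA : A.IsHermitian) : (msqrt A).PosSemidef := by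
  obtain ⟨U, a, hU, rfl⟩ := exists_diagIn_of_isHermitian hA
  rw [msqrt_diagIn hU]
  exact posSemidef_diagIn _ fun i => Real.sqrt_nonneg _

lemma msqrt_mul_msqrt {A : Matrix ι ι ℂ} (hA : A.PosSemidef) : msqrt A * msqrt A = A := by
  obtain ⟨U, a, hU, rfl⟩ := exists_diagIn_of_isHermitian hA.1
  rw [msqrt_diagIn hU, diagIn_mul hU]
  congr 1
  ext i
  exact Real.mul_self_sqrt (nonneg_of_posSemidef_diagIn hU hA i)

/-- One half of Uhlmann's theorem, with a contraction instead of a unitary: `Tr √(√τ ρ √τ)` is an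
overlap of `√ρ` with some `Y` such that `Y Y† ≤ τ`. Here `Y = √τ W`, where `W` is the partial
isometry `|M|⁻¹ M†` of the polar decomposition of `M = √ρ √τ`. -/
lemma exists_overlap_eq_fidelity {ρ τ : Matrix ι ι ℂ} (hρ : ρ.PosSemidef) (hτ : τ.PosSemidef) :
    ∃ Y : Matrix ι ι ℂ, Y * Yᴴ ≤ τ ∧
      (msqrt ρ * Y).trace.re = (msqrt (msqrt τ * ρ * msqrt τ)).trace.re := by
  have hX := (posSemidef_msqrt ρ hρ.1).1
  have hT := (posSemidef_msqrt τ hτ.1).1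
  set X := msqrt ρ with hXdef
  set T := msqrt τ with hTdef
  have hG : (T * ρ * T) = (X * T)ᴴ * (X * T) := by
    rw [Matrix.conjTranspose_mul, hX.eq, hT.eq, ← msqrt_mul_msqrt hρ]
    simp only [Matrix.mul_assoc, hXdef]
  have hGpos : (T * ρ * T).PosSemidef := hG ▸ Matrix.posSemidef_conjTranspose_mul_self _
  obtain ⟨U, g, hU, hg⟩ := exists_diagIn_of_isHermitian hGpos.1
  have hg0 := nonneg_of_posSemidef_diagIn hU (hg ▸ hGpos)
  set J := diagIn U fun i => (√(g i))⁻¹ with hJ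
  have hJJ : Jᴴ = J := conjTranspose_diagIn _ _
  refine ⟨T * (J * (X * T)ᴴ), ?_, ?_⟩
  · have hW : J * (T * ρ * T) * J ≤ 1 := by
      have h1 : (1 : Matrix ι ι ℂ) = diagIn U 1 := by
        simpa [diagIn] using (mul_eq_one_comm.1 hU).symm
      rw [hg, diagIn_mul hU, diagIn_mul hU, h1, Matrix.le_iff, diagIn_sub]
      refine posSemidef_diagIn _ fun i => ?_
      rcases (hg0 i).eq_or_lt with h | h
      · simp [← h]
      · have : √(g i) ≠ 0 := (Real.sqrt_pos.2 h).ne'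
        have h' : (√(g i))⁻¹ * g i * (√(g i))⁻¹ = 1 := by
          conv_lhs => rw [← Real.mul_self_sqrt h.le, Real.sqrt_mul_self (Real.sqrt_nonneg _)]
          field_simp
        simp [h']
    have e : T * (J * (X * T)ᴴ) * (T * (J * (X * T)ᴴ))ᴴ = T * (J * (T * ρ * T) * J) * Tᴴ := by
      rw [hG]
      simp only [Matrix.conjTranspose_mul, Matrix.conjTranspose_conjTranspose, hJJ,
        Matrix.mul_assoc]
    have := (Matrix.le_iff.1 hW).mul_mul_conjTranspose_same T
    rw [Matrix.mul_sub, Matrix.sub_mul, Matrix.mul_one, hT.eq, msqrt_mul_msqrt hτ] at this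
    rw [Matrix.le_iff, e, hT.eq]
    exact this
  · have e : (X * (T * (J * (X * T)ᴴ))).trace = (J * (T * ρ * T)).trace := by
      rw [← Matrix.mul_assoc, Matrix.trace_mul_comm, hG, Matrix.mul_assoc]
    rw [e, hg, diagIn_mul hU, msqrt_diagIn hU, trace_diagIn hU, trace_diagIn hU]
    congr 2
    refine Finset.sum_congr rfl fun i _ => ?_
    rcases (hg0 i).eq_or_lt with h | h
    · simp [← h]
    · have : √(g i) ≠ 0 := (Real.sqrt_pos.2 h).ne'
      rw [Pi.mul_apply, inv_mul_eq_iff_eq_mul₀ this, Real.mul_self_sqrt h.le]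

/-- The Fuchs–van de Graaf inequality. With `X = √ρ`, `Y` as in Uhlmann's theorem and
`S = 2 P - 1` the sign of `ρ - τ`, the identity
`Re Tr S (X X† - Y Y†) = Re Tr S (X - Y) (X + Y)†` reduces it to the Cauchy–Schwarz inequality,
which enters as the non-positivity of the discriminant of a quadratic polynomial. -/
lemma genTraceDist_le_purifiedDist {ρ τ : Matrix ι ι ℂ} (hρ : IsState ρ) (hτ : IsSubState τ) :
    genTraceDist τ ρ ≤ purifiedDist τ ρ := by
  obtain ⟨P, M, hP, hPP, hP0, rfl, hM0, -, hD⟩ := exists_projection_genTraceDist hρ hτ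
  obtain ⟨Y, hY, hF⟩ := exists_overlap_eq_fidelity hρ.1 hτ.1
  have hX := (posSemidef_msqrt ρ hρ.1.1).1
  have hXX := msqrt_mul_msqrt hρ.1
  set X := msqrt ρ with hXdef
  have hFid : genFidelity τ ρ = (X * Y).trace.re := by
    simp [genFidelity, hρ.2, hF]
  rw [purifiedDist, hFid]
  set F := (X * Y).trace.re with hFdef
  set D := genTraceDist τ ρ with hDdef
  have hD0 : 0 ≤ D := by
    rw [hD]
    exact (Complex.le_def.1 (Matrix.nonneg_iff_posSemidef.1 hM0).trace_nonneg).1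
  set t := (Y * Yᴴ).trace.re with ht
  have hXXt : (X * Xᴴ).trace.re = 1 := by rw [hX.eq, hXX, hρ.2, Complex.one_re]
  have hYX : (Y * Xᴴ).trace.re = F := by rw [hX.eq, Matrix.trace_mul_comm]
  have hXY : (X * Yᴴ).trace.re = F := by rw [← re_trace_mul_conjTranspose_comm, hYX]
  have ht1 : t ≤ 1 := by
    have := re_trace_mul_le_left hY (zero_le_one (α := Matrix ι ι ℂ))
    rw [Matrix.one_mul, Matrix.one_mul] at this
    exact this.trans hτ.2
  have hF1 : F ≤ 1 := by
    have := two_mul_re_trace_mul_conjTranspose_le X Y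
    linarith
  set S : Matrix ι ι ℂ := 2 • P - 1 with hS
  have hSS : S * S = 1 := by
    simp only [hS, two_smul, Matrix.sub_mul, Matrix.mul_sub, Matrix.add_mul, Matrix.mul_add, hPP,
      Matrix.mul_one, Matrix.one_mul]
    abel
  have hSH : Sᴴ = S := by
    simp [hS, two_smul, hP]
  -- `2 D ≤ Re Tr S (X - Y) (X + Y)† + (1 - t)`, since `Y Y† ≤ τ`.
  have hmain : 2 * D ≤ (S * (X - Y) * (X + Y)ᴴ).trace.re + (1 - t) := by
    have h1 : D ≤ (P * (X * Xᴴ - Y * Yᴴ)).trace.re := by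
      rw [hD, hX.eq, hXX]
      exact re_trace_mul_le_left (sub_le_sub_left hY ρ) hP0
    have h2 : (S * (X * Yᴴ)).trace.re = (S * (Y * Xᴴ)).trace.re := by
      have := re_trace_mul_conjTranspose_comm (S * Y) X
      rw [Matrix.conjTranspose_mul, hSH, ← Matrix.mul_assoc, Matrix.trace_mul_comm,
        Matrix.mul_assoc] at this
      exact this
    have h3 : (S * (X - Y) * (X + Y)ᴴ).trace.re
        = (S * (X * Xᴴ)).trace.re - (S * (Y * Yᴴ)).trace.re := by
      simp only [Matrix.conjTranspose_add, Matrix.mul_sub, Matrix.mul_add, Matrix.sub_mul,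
        Matrix.trace_sub, Matrix.trace_add, Complex.sub_re, Complex.add_re, Matrix.mul_assoc] at h2 ⊢
      linarith
    have h4 : ∀ Z : Matrix ι ι ℂ, (S * Z).trace.re = 2 * (P * Z).trace.re - Z.trace.re := by
      intro Z
      simp [hS, two_smul, Matrix.sub_mul, Matrix.add_mul]
      ring
    rw [Matrix.mul_sub, Matrix.trace_sub, Complex.sub_re] at h1
    rw [h3, h4, h4, hXXt]
    linarith
  -- Cauchy–Schwarz with weight `c`; the summand `1 - t` is absorbed through `2 c ≤ c² + 1`.
  have hquad : ∀ c : ℝ, 0 ≤ (1 - F) * (c * c) + (-(2 * D)) * c + (1 + F) := by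
    intro c
    have hexp : ((X + Y) * (X + Y)ᴴ).trace.re = 1 + t + 2 * F := by
      simp only [Matrix.conjTranspose_add, Matrix.mul_add, Matrix.add_mul, Matrix.trace_add,
        Complex.add_re, hXXt, hYX, hXY, ← ht]
      ring
    have hexp' : (S * (X - Y) * (S * (X - Y))ᴴ).trace.re = 1 + t - 2 * F := by
      have : (S * (X - Y) * (S * (X - Y))ᴴ).trace = ((X - Y) * (X - Y)ᴴ).trace := by
        rw [Matrix.conjTranspose_mul, hSH, ← Matrix.mul_assoc, Matrix.trace_mul_comm,
          ← Matrix.mul_assoc, ← Matrix.mul_assoc, hSS, Matrix.one_mul]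
      rw [this]
      simp only [Matrix.conjTranspose_sub, Matrix.mul_sub, Matrix.sub_mul, Matrix.trace_sub,
        Complex.sub_re, hXXt, hYX, hXY, ← ht]
      ring
    have hcs := two_mul_re_trace_mul_conjTranspose_le (c • (S * (X - Y))) (X + Y)
    simp only [Matrix.conjTranspose_smul, Matrix.smul_mul, Matrix.mul_smul, Matrix.trace_smul,
      Complex.smul_re, smul_eq_mul, hexp, hexp', star_trivial] at hcs
    rcases le_total 0 c with hc | hc
    · have := mul_le_mul_of_nonneg_left hmain hc
      nlinarith [mul_nonneg (sub_nonneg.2 ht1) (sq_nonneg (c - 1))]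
    · have h1F : 0 ≤ 1 + F := by
        have := (Complex.le_def.1
          (Matrix.posSemidef_self_mul_conjTranspose (X + Y)).trace_nonneg).1
        rw [hexp, Complex.zero_re] at this
        linarith
      have := mul_nonneg (sub_nonneg.2 hF1) (mul_self_nonneg c)
      have := mul_nonneg hD0 (neg_nonneg.2 hc)
      linarith
  have hdisc := discrim_le_zero hquad
  rw [discrim] at hdisc
  refine Real.le_sqrt_of_sq_le ?_
  linarith

end FuchsVanDeGraaf

/-! ### The smallest smoothing parameter -/

section Smoothing

open scoped MatrixOrder Matrix

variable {ι : Type*}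

lemma Dmax_le {τ σ : Matrix ι ι ℂ} {l : ℝ} (h : ((2 : ℝ) ^ l • σ - τ).PosSemidef) :
    Dmax τ σ ≤ l :=
  iInf₂_le l h

variable [Fintype ι]

lemma bddBelow_smoothing (d : Matrix ι ι ℂ → Matrix ι ι ℂ → ℝ) (ρ σ : Matrix ι ι ℂ) (r : ℝ) :
    BddBelow {ε : ℝ | 0 ≤ ε ∧ smoothDmax d ε ρ σ ≤ (r : EReal)} :=
  ⟨0, fun _ h => h.1⟩

lemma minSmoothing_nonneg (d : Matrix ι ι ℂ → Matrix ι ι ℂ → ℝ) (ρ σ : Matrix ι ι ℂ) (r : ℝ) :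
    0 ≤ minSmoothing d ρ σ r :=
  Real.sInf_nonneg fun _ h => h.1

lemma mem_smoothing_of_substate {d : Matrix ι ι ℂ → Matrix ι ι ℂ → ℝ} {ρ σ τ : Matrix ι ι ℂ}
    {ε r : ℝ} (hε : 0 ≤ ε) (hτ : IsSubState τ) (hd : d τ ρ ≤ ε)
    (h : ((2 : ℝ) ^ r • σ - τ).PosSemidef) :
    ε ∈ {ε : ℝ | 0 ≤ ε ∧ smoothDmax d ε ρ σ ≤ (r : EReal)} :=
  ⟨hε, (iInf₂_le τ ⟨hτ, hd⟩).trans (Dmax_le h)⟩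

/-- The zero operator is admissible, so the set of smoothing parameters is non-empty. -/
lemma one_mem_smoothing {d : Matrix ι ι ℂ → Matrix ι ι ℂ → ℝ} {ρ σ : Matrix ι ι ℂ}
    (hσ : σ.PosSemidef) (hd : d 0 ρ ≤ 1) (r : ℝ) :
    (1 : ℝ) ∈ {ε : ℝ | 0 ≤ ε ∧ smoothDmax d ε ρ σ ≤ (r : EReal)} := by
  refine mem_smoothing_of_substate zero_le_one ⟨Matrix.PosSemidef.zero, by simp⟩ hd ?_
  rw [sub_zero]
  exact hσ.smul (by positivity)

variable [DecidableEq ι]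

lemma purifiedDist_le_one (ρ τ : Matrix ι ι ℂ) : purifiedDist τ ρ ≤ 1 :=
  Real.sqrt_le_one.2 (by linarith [sq_nonneg (genFidelity τ ρ)])

lemma minSmoothing_genTraceDist_le {ρ σ : Matrix ι ι ℂ} (hρ : IsState ρ) (hσ : σ.PosSemidef)
    (r : ℝ) : minSmoothing genTraceDist ρ σ r ≤ minSmoothing purifiedDist ρ σ r := by
  refine csInf_le_csInf (bddBelow_smoothing _ _ _ _)
    ⟨1, one_mem_smoothing hσ (purifiedDist_le_one _ _) r⟩ ?_
  rintro ε ⟨hε, h⟩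
  refine ⟨hε, le_trans (le_iInf₂ fun τ hτ => ?_) h⟩
  exact iInf₂_le τ ⟨hτ.1, (genTraceDist_le_purifiedDist hρ hτ.1).trans hτ.2⟩

lemma one_sub_minSmoothing_le {ρ σ : Matrix ι ι ℂ} (hρ : IsState ρ) (hσ : σ.PosSemidef) (r : ℝ)
    {α : ℝ} (h0 : 0 ≤ α) (h1 : α < 1) :
    1 - minSmoothing genTraceDist ρ σ r
      ≤ (2 : ℝ) ^ (r * (1 - α)) * (mpow ρ α * mpow σ (1 - α)).trace.re := by
  set Q := (mpow ρ α * mpow σ (1 - α)).trace.re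
  have hQ : 0 ≤ Q := re_trace_mul_nonneg (posSemidef_mpow hρ.1 _) (posSemidef_mpow hσ _)
  have h0' : genTraceDist 0 ρ ≤ 1 :=
    (genTraceDist_le_purifiedDist hρ ⟨Matrix.PosSemidef.zero, by simp⟩).trans
      (purifiedDist_le_one _ _)
  suffices h : 1 - (2 : ℝ) ^ (r * (1 - α)) * Q ≤ minSmoothing genTraceDist ρ σ r by linarith
  refine le_csInf ⟨1, one_mem_smoothing hσ h0' r⟩ ?_
  rintro ε ⟨hε, h⟩
  -- The infima defining `smoothDmax` need not be attained: compare with every `R > r`.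
  have key : ∀ R > r, 1 - (2 : ℝ) ^ (R * (1 - α)) * Q ≤ ε := fun R hR => by
    have hlt : smoothDmax genTraceDist ε ρ σ < (R : EReal) :=
      h.trans_lt (EReal.coe_lt_coe_iff.2 hR)
    obtain ⟨τ, hτ⟩ := iInf_lt_iff.1 hlt
    obtain ⟨⟨hτs, hτd⟩, hτD⟩ := iInf_lt_iff.1 hτ
    obtain ⟨l, hl⟩ := iInf_lt_iff.1 hτD
    obtain ⟨hl1, hl2⟩ := iInf_lt_iff.1 hl
    have k1 := one_sub_genTraceDist_le hρ hσ hτs hl1 h0 h1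
    have k2 : (2 : ℝ) ^ (l * (1 - α)) ≤ 2 ^ (R * (1 - α)) :=
      Real.rpow_le_rpow_of_exponent_le (by norm_num)
        (mul_le_mul_of_nonneg_right (EReal.coe_lt_coe_iff.1 hl2).le (by linarith))
    have k3 := mul_le_mul_of_nonneg_right k2 hQ
    linarith
  have hcont : Continuous fun R : ℝ => 1 - (2 : ℝ) ^ (R * (1 - α)) * Q :=
    continuous_const.sub (((Real.continuous_const_rpow (by norm_num)).comp
      (continuous_id.mul continuous_const)).mul continuous_const)
  refine le_of_tendsto ((hcont.tendsto r).mono_left (nhdsWithin_le_nhds (s := Set.Ioi r))) ?_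
  filter_upwards [self_mem_nhdsWithin] with R hR using key R hR

lemma traceNorm_of_posSemidef {A : Matrix ι ι ℂ} (hA : A.PosSemidef) :
    traceNorm A = A.trace.re := by
  obtain ⟨U, a, hU, rfl⟩ := exists_diagIn_of_isHermitian hA.1
  rw [traceNorm_diagIn hU, trace_diagIn hU, Complex.ofReal_re]
  exact Finset.sum_congr rfl fun i _ => abs_of_nonneg (nonneg_of_posSemidef_diagIn hU hA i)

/-- Any `0 ≤ τ ≤ ρ` with `τ ≤ 2^r σ` is admissible for the smoothing parameter `1 - Tr τ`. -/
lemma trace_le_one_sub_minSmoothing {ρ σ τ : Matrix ι ι ℂ} (hρ : IsState ρ) (hτ : τ.PosSemidef)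
    (hτρ : (ρ - τ).PosSemidef) {r : ℝ} (hτσ : ((2 : ℝ) ^ r • σ - τ).PosSemidef) :
    τ.trace.re ≤ 1 - minSmoothing genTraceDist ρ σ r := by
  have htr : (ρ - τ).trace.re = 1 - τ.trace.re := by
    rw [Matrix.trace_sub, hρ.2, Complex.sub_re, Complex.one_re]
  have h0 : 0 ≤ 1 - τ.trace.re := htr ▸ (Complex.le_def.1 hτρ.trace_nonneg).1
  have hτs : IsSubState τ := ⟨hτ, by linarith⟩
  have hd : genTraceDist τ ρ ≤ 1 - τ.trace.re := by
    rw [genTraceDist_eq_of_sub_state hρ hτs, traceNorm_of_posSemidef hτρ, htr]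
    linarith
  have := csInf_le (bddBelow_smoothing _ _ _ _) (mem_smoothing_of_substate h0 hτs hd hτσ)
  rw [minSmoothing]
  linarith

end Smoothing

/-! ### The lower bound on the exponents -/

section Exponents

variable {ι : Type*} [Fintype ι] [DecidableEq ι]

lemma log2_of_pos {x : ℝ} (hx : 0 < x) : log2 x = (Real.logb 2 x : ℝ) :=
  if_neg (not_le.2 hx)

lemma log2_of_nonpos {x : ℝ} (hx : x ≤ 0) : log2 x = ⊥ :=
  if_pos hx

lemma log2_mono {x y : ℝ} (h : x ≤ y) : log2 x ≤ log2 y := by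
  rcases le_or_gt x 0 with hx | hx
  · rw [log2_of_nonpos hx]
    exact bot_le
  · rw [log2_of_pos hx, log2_of_pos (hx.trans_le h), EReal.coe_le_coe_iff]
    exact Real.logb_le_logb_of_le (by norm_num) hx h

lemma neg_log2_div_anti {x y : ℝ} (h : x ≤ y) (n : ℕ) :
    -log2 y / (n : EReal) ≤ -log2 x / (n : EReal) :=
  EReal.div_le_div_right_of_nonneg (Nat.cast_nonneg' n) (EReal.neg_le_neg_iff.2 (log2_mono h))

lemma neg_log2_div_of_nonpos {x : ℝ} (h : x ≤ 0) {n : ℕ} (hn : 0 < n) :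
    -log2 x / (n : EReal) = ⊤ := by
  rw [log2_of_nonpos h, EReal.neg_bot]
  exact EReal.top_div_of_pos_ne_top (by exact_mod_cast hn) (EReal.natCast_ne_top n)

lemma neg_log2_two_rpow_div (c : ℝ) {n : ℕ} (hn : 0 < n) :
    -log2 ((2 : ℝ) ^ (-(n * c))) / (n : EReal) = c := by
  rw [log2_of_pos (by positivity), Real.logb_rpow (by norm_num) (by norm_num), ← EReal.coe_neg,
    neg_neg, ← EReal.coe_natCast, ← EReal.coe_div, mul_div_cancel_left₀]
  exact_mod_cast hn.ne'

lemma renyi_term_of_trace_pos {ρ σ : Matrix ι ι ℂ} (r : ℝ) {α : ℝ} (h1 : α < 1)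
    (hQ : 0 < (mpow ρ α * mpow σ (1 - α)).trace.re) :
    ((α - 1 : ℝ) : EReal) * ((r : EReal) - petzRenyi α ρ σ)
      = ((-(r * (1 - α) + Real.logb 2 (mpow ρ α * mpow σ (1 - α)).trace.re) : ℝ) : EReal) := by
  have h : α - 1 ≠ 0 := by linarith
  rw [petzRenyi, if_neg h1.ne, if_neg (fun h => absurd h.1 h1.not_gt), log2_of_pos hQ,
    ← EReal.coe_mul, ← EReal.coe_sub, ← EReal.coe_mul]
  congr 1
  field_simp
  ring

lemma renyi_term_of_trace_nonpos {ρ σ : Matrix ι ι ℂ} (r : ℝ) {α : ℝ} (h1 : α < 1)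
    (hQ : (mpow ρ α * mpow σ (1 - α)).trace.re ≤ 0) :
    ((α - 1 : ℝ) : EReal) * ((r : EReal) - petzRenyi α ρ σ) = ⊤ := by
  rw [petzRenyi, if_neg h1.ne, if_neg (fun h => absurd h.1 h1.not_gt), log2_of_nonpos hQ,
    EReal.coe_mul_bot_of_neg (one_div_neg.2 (by linarith)), EReal.sub_top,
    EReal.coe_mul_bot_of_neg (by linarith)]

lemma renyiBound_le_scExponent_genTraceDist {ρ σ : Matrix ι ι ℂ} (hρ : IsState ρ)
    (hσ : σ.PosSemidef) (r : ℝ) {n : ℕ} (hn : 0 < n) :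
    renyiBound ρ σ r ≤ scExponent (fun _ => genTraceDist) ρ σ r n := by
  refine iSup₂_le fun α hα => ?_
  rcases hα.2.eq_or_lt with rfl | h1
  · rw [sub_self, EReal.coe_zero, zero_mul, scExponent]
    have := neg_log2_two_rpow_div 0 hn
    rw [EReal.coe_zero] at this
    rw [← this]
    refine neg_log2_div_anti ?_ n
    rw [mul_zero, neg_zero, Real.rpow_zero]
    linarith [minSmoothing_nonneg genTraceDist (tensorPower ρ n) (tensorPower σ n) (n * r)]
  · have key := one_sub_minSmoothing_le (hρ.tensorPower n) (posSemidef_tensorPower hσ n) (n * r)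
      hα.1 h1
    set Q := (mpow ρ α * mpow σ (1 - α)).trace.re with hQdef
    have hQn : (mpow (tensorPower ρ n) α * mpow (tensorPower σ n) (1 - α)).trace.re = Q ^ n := by
      have him : ((Q : ℝ) : ℂ) = (mpow ρ α * mpow σ (1 - α)).trace := by
        refine Complex.conj_eq_iff_re.1 ?_
        have e1 := (posSemidef_mpow hρ.1 α).1
        have e2 := (posSemidef_mpow hσ (1 - α)).1
        rw [starRingEnd_apply, ← Matrix.trace_conjTranspose, Matrix.conjTranspose_mul, e1.eq, e2.eq,
          Matrix.trace_mul_comm]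
      rw [mpow_tensorPower hρ.1, mpow_tensorPower hσ, ← tensorPower_mul, trace_tensorPower, ← him,
        ← Complex.ofReal_pow, Complex.ofReal_re]
    rw [hQn] at key
    have hQ0 : 0 ≤ Q := re_trace_mul_nonneg (posSemidef_mpow hρ.1 _) (posSemidef_mpow hσ _)
    rcases hQ0.eq_or_lt with hQ | hQ
    · rw [scExponent, neg_log2_div_of_nonpos _ hn]
      · exact le_top
      · rwa [← hQ, zero_pow hn.ne', mul_zero] at key
    · rw [renyi_term_of_trace_pos r h1 hQ, ← neg_log2_two_rpow_div _ hn, scExponent]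
      refine neg_log2_div_anti (key.trans_eq ?_) n
      rw [mul_neg, neg_neg, mul_add, Real.rpow_add (by norm_num), mul_assoc, ← hQdef,
        mul_comm (n : ℝ) (Real.logb 2 Q), Real.rpow_mul (by norm_num) (Real.logb 2 Q),
        Real.rpow_logb (by norm_num) (by norm_num) hQ, Real.rpow_natCast]

lemma scExponent_genTraceDist_le_purifiedDist {ρ σ : Matrix ι ι ℂ} (hρ : IsState ρ)
    (hσ : σ.PosSemidef) (r : ℝ) (n : ℕ) :
    scExponent (fun _ => genTraceDist) ρ σ r n ≤ scExponent (fun _ => purifiedDist) ρ σ r n :=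
  neg_log2_div_anti (sub_le_sub_left (minSmoothing_genTraceDist_le (hρ.tensorPower n)
    (posSemidef_tensorPower hσ n) _) 1) n

end Exponents

/-! ### The classical Chernoff bound -/

section Chernoff

variable {κ : Type*} [Fintype κ]

lemma sum_prod_eq_one {w : κ → ℝ} (hw : ∑ i, w i = 1) (n : ℕ) :
    ∑ x : Fin n → κ, ∏ i, w (x i) = 1 := by
  rw [sum_prod_eq_pow, hw, one_pow]

lemma sum_fin_succ (n : ℕ) (f : (Fin (n + 1) → κ) → ℝ) :
    ∑ x, f x = ∑ k, ∑ x : Fin n → κ, f (Fin.cons k x) := by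
  rw [← Fintype.sum_prod_type', ← (Fin.consEquiv fun _ => κ).sum_comp]
  rfl

lemma sum_prod_mul_sum_eq_zero {w l : κ → ℝ} (hw : ∑ i, w i = 1) (hl : ∑ i, w i * l i = 0)
    (n : ℕ) : ∑ x : Fin n → κ, (∏ i, w (x i)) * ∑ i, l (x i) = 0 := by
  induction n with
  | zero => simp
  | succ n ih =>
    rw [sum_fin_succ]
    simp only [Fin.prod_univ_succ, Fin.sum_univ_succ, Fin.cons_zero, Fin.cons_succ]
    have : ∀ k : κ, ∑ x : Fin n → κ, w k * (∏ i, w (x i)) * (l k + ∑ i, l (x i))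
        = w k * l k := fun k => by
      calc _ = w k * l k * (∑ x : Fin n → κ, ∏ i, w (x i))
          + w k * ∑ x : Fin n → κ, (∏ i, w (x i)) * ∑ i, l (x i) := by
            rw [Finset.mul_sum, Finset.mul_sum, ← Finset.sum_add_distrib]
            exact Finset.sum_congr rfl fun x _ => by ring
        _ = _ := by rw [sum_prod_eq_one hw, ih]; ring
    simp only [this, hl]

/-- The variance of a sum of `n` independent centred variables is `n` times the variance. -/
lemma sum_prod_mul_sum_sq {w l : κ → ℝ} (hw : ∑ i, w i = 1) (hl : ∑ i, w i * l i = 0) (n : ℕ) :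
    ∑ x : Fin n → κ, (∏ i, w (x i)) * (∑ i, l (x i)) ^ 2 = n * ∑ i, w i * l i ^ 2 := by
  induction n with
  | zero => simp
  | succ n ih =>
    rw [sum_fin_succ]
    simp only [Fin.prod_univ_succ, Fin.sum_univ_succ, Fin.cons_zero, Fin.cons_succ]
    have : ∀ k : κ, ∑ x : Fin n → κ, w k * (∏ i, w (x i)) * (l k + ∑ i, l (x i)) ^ 2
        = w k * l k ^ 2 + w k * (n * ∑ i, w i * l i ^ 2) := fun k => by
      calc _ = w k * l k ^ 2 * (∑ x : Fin n → κ, ∏ i, w (x i))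
          + 2 * w k * l k * (∑ x : Fin n → κ, (∏ i, w (x i)) * ∑ i, l (x i))
          + w k * ∑ x : Fin n → κ, (∏ i, w (x i)) * (∑ i, l (x i)) ^ 2 := by
            rw [Finset.mul_sum, Finset.mul_sum, Finset.mul_sum, ← Finset.sum_add_distrib,
              ← Finset.sum_add_distrib]
            exact Finset.sum_congr rfl fun x _ => by ring
        _ = _ := by
            rw [sum_prod_eq_one hw, ih, sum_prod_mul_sum_eq_zero hw hl]
            ring
    simp only [this, Finset.sum_add_distrib, ← Finset.sum_mul, hw]
    push_cast
    ring

/-- First-order conditions for a minimum over `[0, 1]`, including the end points. -/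
lemma deriv_signs_of_isMinOn_Icc {f : ℝ → ℝ} {m α : ℝ} (hα : α ∈ Set.Icc (0 : ℝ) 1)
    (hmin : IsMinOn f (Set.Icc 0 1) α) (hf : HasDerivAt f m α) :
    0 ≤ (1 - α) * m ∧ α * m ≤ 0 := by
  rw [isMinOn_iff] at hmin
  constructor
  · rcases hα.2.eq_or_lt with h | h
    · simp [h]
    · refine mul_nonneg (by linarith) ?_
      have ht := (hasDerivWithinAt_iff_tendsto_slope' (by simp)).1
        (hf.hasDerivWithinAt (s := Set.Ioi α))
      refine ge_of_tendsto ht ?_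
      filter_upwards [Ioo_mem_nhdsGT h] with β hβ
      rw [slope_def_field]
      exact div_nonneg (sub_nonneg.2 (hmin β ⟨hα.1.trans hβ.1.le, hβ.2.le⟩))
        (sub_nonneg.2 hβ.1.le)
  · rcases hα.1.eq_or_lt with h | h
    · simp [← h]
    · refine mul_nonpos_of_nonneg_of_nonpos h.le ?_
      have ht := (hasDerivWithinAt_iff_tendsto_slope' (by simp)).1
        (hf.hasDerivWithinAt (s := Set.Iio α))
      refine le_of_tendsto ht ?_
      filter_upwards [Ioo_mem_nhdsLT h] with β hβ
      rw [slope_def_field]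
      exact div_nonpos_of_nonneg_of_nonpos (sub_nonneg.2 (hmin β ⟨hβ.1.le, hβ.2.le.trans hα.2⟩))
        (sub_nonpos.2 hβ.2.le)

/-- The achievability half of Chernoff's theorem for the weights `exp A` and `exp B`. At a minimiser
`α` of `Z α = ∑ exp (α A + (1 - α) B)`, consider the tilted distribution
`w = exp (α A + (1 - α) B) / Z α`. By the first-order conditions the drift of `A - B` under `w`
does not lower the minimum, and the fluctuations of a sum of `n` copies are of order `√n`. -/
lemma exists_chernoff_exponent [Nonempty κ] (A B : κ → ℝ) :
    ∃ α ∈ Set.Icc (0 : ℝ) 1, ∃ K : ℝ, ∀ n : ℕ,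
      (∑ i, Real.exp (α * A i + (1 - α) * B i)) ^ n * Real.exp (-(K * √n))
        ≤ ∑ x : Fin n → κ, min (Real.exp (∑ i, A (x i))) (Real.exp (∑ i, B (x i))) := by
  have hderiv : ∀ α : ℝ, HasDerivAt (fun α : ℝ => ∑ i, Real.exp (α * A i + (1 - α) * B i))
      (∑ i, Real.exp (α * A i + (1 - α) * B i) * (A i - B i)) α := fun α => by
    refine HasDerivAt.fun_sum fun i _ => HasDerivAt.exp ?_
    have := ((hasDerivAt_id α).mul_const (A i)).add
      (((hasDerivAt_id α).const_sub 1).mul_const (B i))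
    exact this.congr_deriv (by ring)
  obtain ⟨α, hα, hmin⟩ := isCompact_Icc.exists_isMinOn (Set.nonempty_Icc.2 zero_le_one)
    (fun α _ => (hderiv α).continuousAt.continuousWithinAt)
  obtain ⟨hs1, hs2⟩ := deriv_signs_of_isMinOn_Icc hα hmin (hderiv α)
  set e : κ → ℝ := fun i => Real.exp (α * A i + (1 - α) * B i) with he
  set Z := ∑ i, e i with hZ
  have hZpos : 0 < Z := Finset.sum_pos (fun i _ => Real.exp_pos _) Finset.univ_nonempty
  let w : κ → ℝ := fun i => e i / Z
  have hw : ∑ i, w i = 1 := by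
    rw [← Finset.sum_div]
    exact div_self hZpos.ne'
  let μ := (∑ i, e i * (A i - B i)) / Z
  have hμ1 : 0 ≤ (1 - α) * μ := by
    rw [← mul_div_assoc]
    exact div_nonneg hs1 hZpos.le
  have hμ2 : α * μ ≤ 0 := by
    rw [← mul_div_assoc]
    exact div_nonpos_of_nonpos_of_nonneg hs2 hZpos.le
  let l : κ → ℝ := fun i => A i - B i - μ
  have hl : ∑ i, w i * l i = 0 := by
    have : ∑ i, w i * (A i - B i) = μ := by
      simp only [w, μ, Finset.sum_div]
      exact Finset.sum_congr rfl fun i _ => by ring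
    simp only [l, mul_sub _ _ μ, Finset.sum_sub_distrib, this, ← Finset.sum_mul, hw]
    ring
  let V := ∑ i, w i * l i ^ 2
  refine ⟨α, hα, (V + 1) / 2, fun n => ?_⟩
  let W : (Fin n → κ) → ℝ := fun x => ∏ i, w (x i)
  let S : (Fin n → κ) → ℝ := fun x => ∑ i, l (x i)
  have hW0 : ∀ x, 0 ≤ W x := fun x =>
    Finset.prod_nonneg fun i _ => div_nonneg (Real.exp_pos _).le hZpos.le
  have hW1 : ∑ x, W x = 1 := sum_prod_eq_one hw n
  have habs : ∑ x, W x * |S x| ≤ (V + 1) / 2 * √n := by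
    rcases Nat.eq_zero_or_pos n with rfl | hn
    · simp [S]
    have hn' : 0 < √(n : ℝ) := Real.sqrt_pos.2 (by exact_mod_cast hn)
    -- The arithmetic-geometric mean inequality replaces the Cauchy–Schwarz inequality.
    have h1 : ∀ x, W x * |S x| ≤ (W x * S x ^ 2) * (1 / (2 * √n)) + W x * (√n / 2) := fun x => by
      have : |S x| ≤ S x ^ 2 * (1 / (2 * √n)) + √n / 2 := by
        have h := two_mul_le_add_sq |S x| √n
        rw [sq_abs] at h
        have e1 : S x ^ 2 * (1 / (2 * √n)) + √n / 2 = (S x ^ 2 + √n ^ 2) / (2 * √n) := by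
          field_simp
        rw [e1, le_div_iff₀ (by positivity)]
        linarith
      calc _ ≤ W x * (S x ^ 2 * (1 / (2 * √n)) + √n / 2) := mul_le_mul_of_nonneg_left this (hW0 x)
        _ = _ := by ring
    refine (Finset.sum_le_sum fun x _ => h1 x).trans (le_of_eq ?_)
    rw [Finset.sum_add_distrib, ← Finset.sum_mul, ← Finset.sum_mul, hW1,
      sum_prod_mul_sum_sq hw hl n]
    have hsq : (n : ℝ) = √n * √n := (Real.mul_self_sqrt (Nat.cast_nonneg n)).symm
    change (n : ℝ) * V * (1 / (2 * √n)) + 1 * (√n / 2) = _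
    conv_lhs => rw [hsq, Real.sqrt_mul_self (Real.sqrt_nonneg _)]
    field_simp
  set c := (V + 1) / 2 * √n with hc
  have hmin : ∀ x : Fin n → κ, Z ^ n * (W x * Real.exp (-|S x|))
      ≤ min (Real.exp (∑ i, A (x i))) (Real.exp (∑ i, B (x i))) := fun x => by
    have hZW : Z ^ n * W x = Real.exp (α * ∑ i, A (x i) + (1 - α) * ∑ i, B (x i)) := by
      simp only [W, w, Finset.prod_div_distrib, Finset.prod_const, Finset.card_univ,
        Fintype.card_fin, he, ← Real.exp_sum, Finset.sum_add_distrib, Finset.mul_sum]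
      field_simp
    have hS : ∑ i, A (x i) - ∑ i, B (x i) = S x + n * μ := by
      simp [S, l, Finset.sum_sub_distrib]
    have hn0 : (0 : ℝ) ≤ n := Nat.cast_nonneg n
    rw [← mul_assoc, hZW, ← Real.exp_add]
    have k1 := mul_nonneg hn0 hμ1
    have k2 := mul_nonneg hn0 (neg_nonneg.2 hμ2)
    have k3 : -|S x| ≤ (1 - α) * S x := by
      have := abs_mul (1 - α) (S x)
      rw [abs_of_nonneg (by linarith [hα.2] : 0 ≤ 1 - α)] at this
      have h5 := mul_le_of_le_one_left (abs_nonneg (S x)) (by linarith [hα.1] : 1 - α ≤ 1)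
      linarith [neg_abs_le ((1 - α) * S x)]
    have k4 : -|S x| ≤ -(α * S x) := by
      have := abs_mul α (S x)
      rw [abs_of_nonneg hα.1] at this
      have h5 := mul_le_of_le_one_left (abs_nonneg (S x)) hα.2
      linarith [le_abs_self (α * S x)]
    have k5 : (1 - α) * (∑ i, A (x i) - ∑ i, B (x i)) = (1 - α) * S x + n * ((1 - α) * μ) := by
      rw [hS]
      ring
    have k6 : α * (∑ i, A (x i) - ∑ i, B (x i)) = α * S x + n * (α * μ) := by
      rw [hS]
      ring
    refine le_min (Real.exp_le_exp.2 ?_) (Real.exp_le_exp.2 ?_)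
    · linarith
    · linarith
  -- Jensen's inequality for `exp`, through the tangent line at `-c`.
  have hjensen : Real.exp (-c) ≤ ∑ x, W x * Real.exp (-|S x|) := by
    have h1 : ∀ x, Real.exp (-c) * (W x * (1 + c) - W x * |S x|) ≤ W x * Real.exp (-|S x|) :=
      fun x => by
        have h := Real.add_one_le_exp (c - |S x|)
        have e1 : Real.exp (-|S x|) = Real.exp (-c) * Real.exp (c - |S x|) := by
          rw [← Real.exp_add]
          congr 1
          ring
        have := mul_le_mul_of_nonneg_left h (mul_nonneg (hW0 x) (Real.exp_pos (-c)).le)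
        rw [e1]
        linarith
    refine le_trans ?_ (Finset.sum_le_sum fun x _ => h1 x)
    rw [← Finset.mul_sum, Finset.sum_sub_distrib, ← Finset.sum_mul, hW1]
    exact le_mul_of_one_le_right (Real.exp_pos _).le (by linarith)
  calc Z ^ n * Real.exp (-c) ≤ Z ^ n * ∑ x, W x * Real.exp (-|S x|) :=
        mul_le_mul_of_nonneg_left hjensen (pow_pos hZpos n).le
    _ = ∑ x, Z ^ n * (W x * Real.exp (-|S x|)) := Finset.mul_sum _ _ _
    _ ≤ _ := Finset.sum_le_sum fun x _ => hmin x

end Chernoff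

/-! ### Achievability for commuting operators -/

section Commuting

open scoped Matrix

variable {ι : Type*} [Fintype ι]

/-- The Chernoff partition function of `p` and `2^r q` over the common support. -/
noncomputable def partitionFn (p q : ι → ℝ) (r α : ℝ) : ℝ :=
  ∑ k : {i // 0 < p i ∧ 0 < q i},
    Real.exp (α * Real.log (p k) + (1 - α) * (r * Real.log 2 + Real.log (q k)))

lemma partitionFn_pos (p q : ι → ℝ) [Nonempty {i // 0 < p i ∧ 0 < q i}] (r α : ℝ) :
    0 < partitionFn p q r α :=
  Finset.sum_pos (fun _ _ => Real.exp_pos _) Finset.univ_nonempty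

variable [DecidableEq ι]

/-- For jointly diagonal `ρ` and `σ`, the entrywise minimum of `ρ^{⊗ n}` and `2^{n r} σ^{⊗ n}` is an
admissible operator. -/
lemma sum_min_le_one_sub_minSmoothing {U : Matrix ι ι ℂ} (hU : Uᴴ * U = 1) {p q : ι → ℝ}
    (hp : ∀ i, 0 ≤ p i) (hq : ∀ i, 0 ≤ q i) (hρ : IsState (diagIn U p)) (r : ℝ) (n : ℕ) :
    ∑ x : Fin n → ι, min (∏ i, p (x i)) ((2 : ℝ) ^ (n * r) * ∏ i, q (x i))
      ≤ 1 - minSmoothing genTraceDist (tensorPower (diagIn U p) n) (tensorPower (diagIn U q) n)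
          (n * r) := by
  have hτ : (diagIn (tensorPower U n)
      fun x => min (∏ i, p (x i)) ((2 : ℝ) ^ (n * r) * ∏ i, q (x i))).PosSemidef :=
    posSemidef_diagIn _ fun x => le_min (Finset.prod_nonneg fun i _ => hp _)
      (mul_nonneg (by positivity) (Finset.prod_nonneg fun i _ => hq _))
  have key := trace_le_one_sub_minSmoothing (σ := tensorPower (diagIn U q) n) (r := n * r)
    (hρ.tensorPower n) hτ ?_ ?_
  · rwa [trace_diagIn (tensorPower_unitary hU n), Complex.ofReal_re] at key
  · rw [tensorPower_diagIn, diagIn_sub]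
    exact posSemidef_diagIn _ fun x => sub_nonneg.2 (min_le_left _ _)
  · rw [tensorPower_diagIn, smul_diagIn, diagIn_sub]
    exact posSemidef_diagIn _ fun x => sub_nonneg.2 (min_le_right _ _)

lemma trace_mpow_mul_mpow_diagIn {U : Matrix ι ι ℂ} (hU : Uᴴ * U = 1) {p q : ι → ℝ}
    (hp : ∀ i, 0 ≤ p i) (hq : ∀ i, 0 ≤ q i) (s t : ℝ) :
    (mpow (diagIn U p) s * mpow (diagIn U q) t).trace.re
      = ∑ k : {i // 0 < p i ∧ 0 < q i}, p k ^ s * q k ^ t := by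
  rw [mpow_diagIn hU, mpow_diagIn hU, diagIn_mul hU, trace_diagIn hU, Complex.ofReal_re,
    ← Finset.sum_subtype (Finset.univ.filter fun i => 0 < p i ∧ 0 < q i) (by simp)
      (fun i => p i ^ s * q i ^ t), Finset.sum_filter]
  refine Finset.sum_congr rfl fun i _ => ?_
  have h1 := (hp i).lt_iff_ne'
  have h2 := (hq i).lt_iff_ne'
  by_cases hpi : p i = 0
  · simp [hpi]
  · by_cases hqi : q i = 0
    · simp [hqi]
    · simp [hpi, hqi, h1, h2]

lemma partitionFn_eq {U : Matrix ι ι ℂ} (hU : Uᴴ * U = 1) {p q : ι → ℝ}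
    (hp : ∀ i, 0 ≤ p i) (hq : ∀ i, 0 ≤ q i) (r α : ℝ) :
    partitionFn p q r α = (2 : ℝ) ^ (r * (1 - α))
      * (mpow (diagIn U p) α * mpow (diagIn U q) (1 - α)).trace.re := by
  rw [trace_mpow_mul_mpow_diagIn hU hp hq, partitionFn, Finset.mul_sum]
  refine Finset.sum_congr rfl fun k _ => ?_
  rw [Real.rpow_def_of_pos (by norm_num), Real.rpow_def_of_pos k.2.1, Real.rpow_def_of_pos k.2.2,
    ← Real.exp_add, ← Real.exp_add]
  congr 1
  ring

/-- At `α = 1` the partition function only sees the part of `p` on the support of `q`, unlike the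
Rényi bound; the inequality extends there by continuity from `α < 1`. -/
lemma neg_logb_partitionFn_le_renyiBound {U : Matrix ι ι ℂ} (hU : Uᴴ * U = 1) {p q : ι → ℝ}
    (hp : ∀ i, 0 ≤ p i) (hq : ∀ i, 0 ≤ q i) [Nonempty {i // 0 < p i ∧ 0 < q i}] (r : ℝ) {α : ℝ}
    (hα : α ∈ Set.Icc (0 : ℝ) 1) :
    ((-Real.logb 2 (partitionFn p q r α) : ℝ) : EReal)
      ≤ renyiBound (diagIn U p) (diagIn U q) r := by
  have hcont : Continuous fun α => ((-Real.logb 2 (partitionFn p q r α) : ℝ) : EReal) := by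
    refine continuous_coe_real_ereal.comp (Continuous.neg ?_)
    refine Continuous.div_const (Continuous.log ?_ fun α => (partitionFn_pos p q r α).ne') _
    unfold partitionFn
    fun_prop
  have hclosed := (isClosed_Iic (a := renyiBound (diagIn U p) (diagIn U q) r)).preimage hcont
  have hsub : Set.Ico (0 : ℝ) 1 ⊆ (fun α => ((-Real.logb 2 (partitionFn p q r α) : ℝ) : EReal)) ⁻¹'
      Set.Iic (renyiBound (diagIn U p) (diagIn U q) r) := fun β hβ => by
    have hZ := partitionFn_pos p q r β
    have hZe := partitionFn_eq hU hp hq r β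
    have hQ : 0 < (mpow (diagIn U p) β * mpow (diagIn U q) (1 - β)).trace.re :=
      pos_of_mul_pos_right (hZe ▸ hZ) (by positivity)
    have h := renyi_term_of_trace_pos (ρ := diagIn U p) (σ := diagIn U q) r hβ.2 hQ
    have e : Real.logb 2 (partitionFn p q r β) = r * (1 - β)
        + Real.logb 2 (mpow (diagIn U p) β * mpow (diagIn U q) (1 - β)).trace.re := by
      rw [hZe, Real.logb_mul (by positivity) hQ.ne', Real.logb_rpow (by norm_num) (by norm_num)]
    rw [Set.mem_preimage, Set.mem_Iic, e, ← h]
    exact le_iSup₂ (f := fun (α : ℝ) (_ : α ∈ Set.Icc (0 : ℝ) 1) =>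
      ((α - 1 : ℝ) : EReal) * ((r : EReal) - petzRenyi α (diagIn U p) (diagIn U q))) β
      ⟨hβ.1, hβ.2.le⟩
  have := hclosed.closure_subset_iff.2 hsub
  rw [closure_Ico (by norm_num)] at this
  exact this hα

lemma renyiBound_eq_top_of_isEmpty {U : Matrix ι ι ℂ} (hU : Uᴴ * U = 1) {p q : ι → ℝ}
    (hp : ∀ i, 0 ≤ p i) (hq : ∀ i, 0 ≤ q i) [IsEmpty {i // 0 < p i ∧ 0 < q i}] (r : ℝ) :
    renyiBound (diagIn U p) (diagIn U q) r = ⊤ := by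
  refine top_le_iff.1 ?_
  rw [← renyi_term_of_trace_nonpos (ρ := diagIn U p) (σ := diagIn U q) (α := 0) r zero_lt_one
    (by rw [trace_mpow_mul_mpow_diagIn hU hp hq]; simp)]
  exact le_iSup₂ (f := fun (α : ℝ) (_ : α ∈ Set.Icc (0 : ℝ) 1) =>
    ((α - 1 : ℝ) : EReal) * ((r : EReal) - petzRenyi α (diagIn U p) (diagIn U q))) 0 (by simp)

lemma limsup_scExponent_le_renyiBound {ρ σ : Matrix ι ι ℂ} (hρ : IsState ρ) (hσ : σ.PosSemidef)
    (hcomm : Commute ρ σ) (r : ℝ) :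
    limsup (fun n : ℕ => scExponent (fun _ => genTraceDist) ρ σ r n) atTop
      ≤ renyiBound ρ σ r := by
  obtain ⟨U, p, q, hU, rfl, rfl⟩ := exists_joint_diagIn hρ.1.1 hσ.1 hcomm
  have hp := nonneg_of_posSemidef_diagIn hU hρ.1
  have hq := nonneg_of_posSemidef_diagIn hU hσ
  rcases isEmpty_or_nonempty {i // 0 < p i ∧ 0 < q i} with hκ | hκ
  · rw [renyiBound_eq_top_of_isEmpty hU hp hq]
    exact le_top
  obtain ⟨α, hα, K, hK⟩ := exists_chernoff_exponent
    (fun k : {i // 0 < p i ∧ 0 < q i} => Real.log (p k))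
    (fun k => r * Real.log 2 + Real.log (q k))
  change ∀ n : ℕ, partitionFn p q r α ^ n * _ ≤ _ at hK
  have hZ := partitionFn_pos p q r α
  have hbound : ∀ n : ℕ, partitionFn p q r α ^ n * Real.exp (-(K * √n))
      ≤ 1 - minSmoothing genTraceDist (tensorPower (diagIn U p) n) (tensorPower (diagIn U q) n)
          (n * r) := fun n => by
    refine (hK n).trans (le_trans ?_ (sum_min_le_one_sub_minSmoothing hU hp hq hρ r n))
    have hinj : Function.Injective
        fun (y : Fin n → {i // 0 < p i ∧ 0 < q i}) (j : Fin n) => (y j : ι) :=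
      fun y z h => funext fun j => Subtype.ext (congrFun h j)
    have hterm : ∀ y : Fin n → {i // 0 < p i ∧ 0 < q i},
        min (Real.exp (∑ j, Real.log (p (y j))))
          (Real.exp (∑ j, (r * Real.log 2 + Real.log (q (y j)))))
        = min (∏ j, p (y j)) ((2 : ℝ) ^ (n * r) * ∏ j, q (y j)) := fun y => by
      congr 1
      · rw [Real.exp_sum]
        exact Finset.prod_congr rfl fun j _ => Real.exp_log (y j).2.1
      · rw [Finset.sum_add_distrib, Real.exp_add, Real.exp_sum (f := fun j => Real.log (q (y j))),
          Real.rpow_def_of_pos (by norm_num : (0 : ℝ) < 2), Finset.sum_const, Finset.card_univ,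
          Fintype.card_fin, nsmul_eq_mul]
        congr 1
        · congr 1
          ring
        · exact Finset.prod_congr rfl fun j _ => Real.exp_log (y j).2.2
    rw [Finset.sum_congr rfl fun y _ => hterm y]
    refine (Finset.sum_map Finset.univ ⟨_, hinj⟩ fun x : Fin n → ι =>
      min (∏ i, p (x i)) ((2 : ℝ) ^ (n * r) * ∏ i, q (x i))).symm.trans_le ?_
    refine Finset.sum_le_univ_sum_of_nonneg fun x => ?_
    exact le_min (Finset.prod_nonneg fun i _ => hp _)
      (mul_nonneg (by positivity) (Finset.prod_nonneg fun i _ => hq _))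
  let c : ℕ → ℝ := fun n => -Real.logb 2 (partitionFn p q r α) + K / Real.log 2 * (√n)⁻¹
  have hc : Tendsto c atTop (𝓝 (-Real.logb 2 (partitionFn p q r α))) := by
    have h := (tendsto_inv_atTop_zero.comp
      (Real.tendsto_sqrt_atTop.comp tendsto_natCast_atTop_atTop)).const_mul (K / Real.log 2)
    simpa using h.const_add (-Real.logb 2 (partitionFn p q r α))
  have hle : ∀ᶠ n : ℕ in atTop,
      scExponent (fun _ => genTraceDist) (diagIn U p) (diagIn U q) r n ≤ ((c n : ℝ) : EReal) := by
    filter_upwards [eventually_gt_atTop 0] with n hn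
    have hn' : (0 : ℝ) < n := by exact_mod_cast hn
    rw [← neg_log2_two_rpow_div (c n) hn]
    refine neg_log2_div_anti (le_trans (le_of_eq ?_) (hbound n)) n
    have hlog : Real.log 2 ≠ 0 := (Real.log_pos (by norm_num)).ne'
    have hsq : (n : ℝ) * (√n)⁻¹ = √n := by
      rw [← div_eq_mul_inv, Real.div_sqrt]
    rw [← Real.exp_log (pow_pos hZ n), ← Real.exp_add, Real.log_pow,
      Real.rpow_def_of_pos (by norm_num)]
    congr 1
    calc Real.log 2 * -(n * c n)
        = n * (Real.log 2 * Real.logb 2 (partitionFn p q r α))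
          - Real.log 2 * (K / Real.log 2) * (n * (√n)⁻¹) := by
          simp only [c]
          ring
      _ = _ := by
          rw [hsq, Real.logb, mul_div_cancel₀ _ hlog, mul_div_cancel₀ _ hlog]
          ring
  calc _ ≤ limsup (fun n => ((c n : ℝ) : EReal)) atTop := limsup_le_limsup hle
    _ = ((-Real.logb 2 (partitionFn p q r α) : ℝ) : EReal) :=
        ((continuous_coe_real_ereal.tendsto _).comp hc).limsup_eq
    _ ≤ _ := neg_logb_partitionFn_le_renyiBound hU hp hq r hα

end Commuting

end QInfo

theorem mainTheorem1 {ι : Type*} [Fintype ι] [DecidableEq ι] (ρ σ : Matrix ι ι ℂ)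
    (hρ : QInfo.IsState ρ) (hσ : σ.PosSemidef) (r : ℝ) :
    QInfo.renyiBound ρ σ r
        ≤ liminf (fun n : ℕ => QInfo.scExponent (fun _ => QInfo.genTraceDist) ρ σ r n) atTop
      ∧ QInfo.renyiBound ρ σ r
        ≤ liminf (fun n : ℕ => QInfo.scExponent (fun _ => QInfo.purifiedDist) ρ σ r n) atTop
      ∧ (Commute ρ σ →
        Tendsto (fun n : ℕ => QInfo.scExponent (fun _ => QInfo.genTraceDist) ρ σ r n) atTop
          (𝓝 (QInfo.renyiBound ρ σ r))) := by
  have h1 : QInfo.renyiBound ρ σ r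
      ≤ liminf (fun n : ℕ => QInfo.scExponent (fun _ => QInfo.genTraceDist) ρ σ r n) atTop := by
    refine le_liminf_of_le (by isBoundedDefault) ?_
    filter_upwards [eventually_gt_atTop 0] with n hn using
      QInfo.renyiBound_le_scExponent_genTraceDist hρ hσ r hn
  refine ⟨h1, h1.trans (liminf_le_liminf (Eventually.of_forall fun n =>
    QInfo.scExponent_genTraceDist_le_purifiedDist hρ hσ r n)), fun hcomm => ?_⟩
  exact tendsto_of_le_liminf_of_limsup_le h1
    (QInfo.limsup_scExponent_le_renyiBound hρ hσ hcomm r)
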